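/- **Setting.** Let $\Gamma$ be a finite simple graph and $V$ a set of vertices of $\Gamma$ whose induced subgraph is connected; put $n=|V|$. Let $\delta V$ be the set of vertices outside $V$ that are adjacent to a vertex of $V$, let $R,S\subseteq\delta V$ (receivers, sources), and let $\alpha_0>0$, $t\ge 0$. For a potential $\eta:V\to\mathbb C$ consider, for $u:V\cup\delta V\to\mathbb C$, the boundary value problem $$\sum_{y\sim x}[u(x)-u(y)]+\alpha_0(1+\eta(x))u(x)=f(x)\ (x\in V),\qquad t\,u(x)+\sum_{y\in V,\,y\sim x}[u(x)-u(y)]=g(x)\ (x\in\delta V).$$ Let $G_0$ be its Green's matrix for $\eta=0$ ($G_0(x,y)$ is the value at $x$ of the solution for a unit source at $y$), let $\Lambda_\eta(s,r)$ be the value at $r\in R$ of the solution with potential $\eta$ for a unit source at $s\in S$, and let $\phi=\phi_\eta\in\mathbb C^{R\times S}$, $\phi(r,s)=G_0(r,s)-\Lambda_\eta(s,r)$, be the scattering data of $\eta$. For $j\ge1$ let $$K_j(\eta_1,\dots,\eta_j)(r,s)=-(-\alpha_0)^j\,G_0^{r;V}D_{\eta_1}G_0^{V;V}D_{\eta_2}\cdots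 G_0^{V;V}D_{\eta_j}G_0^{V;s},\qquad D_\eta=\operatorname{diag}(\eta),$$ so that $\phi_\eta=\sum_{j\ge1}K_j(\eta,\dots,\eta)$ for small $\eta$. Assume $n=|R|\,|S|$ and that the linear map $K_1:\mathbb C^V\to\mathbb C^{R\times S}$ is invertible. The inverse Born operators are $\mathcal K_1=K_1^{-1}$ and, for $j\ge2$, $$\mathcal K_j=-\Big(\sum_{m=1}^{j-1}\mathcal K_m\sum_{i_1+\cdots+i_m=j}K_{i_1}\otimes\cdots\otimes K_{i_m}\Big)\,\mathcal K_1\otimes\cdots\otimes\mathcal K_1 .$$ Let $p,q\in[1,\infty]$ with $1/p+1/q=1$ and put $$\nu_p=\alpha_0\,\big\|\,r\mapsto\|G_0^{r;V}\|_{\ell^q(V)}\big\|_{\ell^p(R)}\ \big\|\,s\mapsto\|G_0^{V;s}\|_{\ell^q(V)}\big\|_{\ell^p(S)},\quad \mu_p=\alpha_0\max_{v\in V}\|G_0^{V;v}\|_{\ell^q(V)},\quad C_p=\min_{\|\eta\|_p=1}\|K_1\eta\|_p,$$ $$r_p=\frac{C_p}{\mu_p}\Big[1-2\frac{\nu_p}{C_p}\Big(\sqrt{1+\tfrac{C_p}{\nu_p}}-1\Big)\Big],\qquad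 \rho_p=\frac1{\mu_p}\Big(1-\sqrt{\tfrac{\nu_p}{C_p+\nu_p}}\Big).$$ **Theorem.** The inverse Born series $\psi(\phi)=\sum_{m\ge1}\mathcal K_m(\phi,\dots,\phi)$ converges for every $\phi\in\mathbb C^{R\times S}$ with $\|\phi\|_p<r_p$, and $$M=\sup\{\|\psi(\phi)\|_p:\ \phi\in\mathbb C^{R\times S},\ \|\phi\|_p<r_p\}$$ is finite. Let $\eta$ be a potential on $V$ that either is real and nonnegative, or is complex with $\|\eta\|_p<\rho_p$, and let $\phi$ be its scattering data. If $\tau<1$ and $\|\phi\|_p<\tau r_p$, then for every integer $N\ge0$ $$\Big\|\eta-\sum_{m=1}^N\mathcal K_m(\phi,\dots,\phi)\Big\|_\infty\le M\Big(\frac1{1-\tau}\Big)^n\Big(\frac{\|\phi\|_p}{\tau r_p}\Big)^N\frac1{1-\frac{\|\phi\|_p}{\tau r_p}},$$ and the inequality is strict if $\phi\neq0$. -/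

import Mathlib

open scoped ENNReal

noncomputable section

namespace GraphOT

/-- The `ℓ^p` norm of a finite family, for `p ∈ [1, ∞]`. -/
def lpNorm {ι E : Type*} [Fintype ι] [NormedAddCommGroup E] (p : ℝ≥0∞) (x : ι → E) : ℝ :=
  ‖WithLp.toLp p x‖

section Graph

variable {W : Type*} [Fintype W] [DecidableEq W] (Γ : SimpleGraph W) [DecidableRel Γ.Adj]
  (V : Finset W)

/-- The vertex boundary `δV`: vertices outside `V` that are adjacent to a vertex of `V`. -/
def boundary : Finset W := {x | x ∉ V ∧ ∃ y ∈ V, Γ.Adj x y}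

/-- The vertices of `V ∪ δV`, as a disjoint union of types. -/
abbrev Vert : Type _ := ↥V ⊕ ↥(boundary Γ V)

/-- The underlying vertex of the ambient graph. -/
def Vert.toW : Vert Γ V → W := Sum.elim Subtype.val Subtype.val

/-- The left-hand side of the boundary value problem: `L u + α₀ (1 + η) u` at the vertices of `V`,
and the Robin boundary operator `t u + ∂u` at the vertices of `δV`. -/
def diffusionOp (α₀ t : ℝ) (η : V → ℂ) (u : Vert Γ V → ℂ) : Vert Γ V → ℂ
  | Sum.inl x =>
      (∑ y : Vert Γ V, if Γ.Adj (x : W) (Vert.toW Γ V y) then u (Sum.inl x) - u y else 0)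
        + (α₀ : ℂ) * (1 + η x) * u (Sum.inl x)
  | Sum.inr x =>
      (t : ℂ) * u (Sum.inr x)
        + ∑ y : V, if Γ.Adj (x : W) (y : W) then u (Sum.inr x) - u (Sum.inl y) else 0

/-- The matrix of the linear operator `diffusionOp`. -/
def diffusionMatrix (α₀ t : ℝ) (η : V → ℂ) : Matrix (Vert Γ V) (Vert Γ V) ℂ :=
  Matrix.of fun x y => diffusionOp Γ V α₀ t η (Pi.single y 1) x

/-- The Green's function with potential `η`: column `y` is the solution `u` of
`diffusionOp η u = δ_y`, i.e. of the boundary value problem with a unit source at `y`. -/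
def green (α₀ t : ℝ) (η : V → ℂ) : Matrix (Vert Γ V) (Vert Γ V) ℂ :=
  (diffusionMatrix Γ V α₀ t η)⁻¹

variable (R S : Finset ↥(boundary Γ V))

/-- The Robin-to-Dirichlet map `Λ_η(s, r) = u(r, s; η)`: the value at the receiver `r` of the
solution with potential `η` for a unit source at `s`. -/
def robinToDirichlet (α₀ t : ℝ) (η : V → ℂ) (s : S) (r : R) : ℂ :=
  green Γ V α₀ t η (Sum.inr r.1) (Sum.inr s.1)

/-- The scattering data `φ(r, s) = G₀(r, s) - Λ_η(s, r)`. -/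
def scatteringData (α₀ t : ℝ) (η : V → ℂ) : R × S → ℂ := fun rs =>
  green Γ V α₀ t 0 (Sum.inr rs.1.1) (Sum.inr rs.2.1) - robinToDirichlet Γ V R S α₀ t η rs.2 rs.1

/-- The block `G₀^{V;V}`. -/
def greenVV (α₀ t : ℝ) : Matrix V V ℂ := (green Γ V α₀ t 0).submatrix Sum.inl Sum.inl

/-- The block `G₀^{R;V}`. -/
def greenRV (α₀ t : ℝ) : Matrix R V ℂ :=
  (green Γ V α₀ t 0).submatrix (fun r => Sum.inr r.1) Sum.inl

/-- The block `G₀^{V;S}`. -/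
def greenVS (α₀ t : ℝ) : Matrix V S ℂ :=
  (green Γ V α₀ t 0).submatrix Sum.inl (fun s => Sum.inr s.1)

/-- The forward operators
`K_j(η₁, …, η_j)(r, s) = -(-α₀)^j G₀^{r;V} D_{η₁} G₀^{V;V} D_{η₂} ⋯ G₀^{V;V} D_{η_j} G₀^{V;s}`,
normalised so that `φ = ∑_{j ≥ 1} K_j(η, …, η)`. (There is no `K_0`; it is set to `0`.) -/
def bornOp (α₀ t : ℝ) : (j : ℕ) → (Fin j → V → ℂ) → R × S → ℂ
  | 0, _ => 0
  | k + 1, η => fun rs =>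
      -(-(α₀ : ℂ)) ^ (k + 1) *
        (greenRV Γ V R α₀ t *
          (List.ofFn fun i : Fin k => Matrix.diagonal (η i.castSucc) * greenVV Γ V α₀ t).prod *
          Matrix.diagonal (η (Fin.last k)) * greenVS Γ V S α₀ t) rs.1 rs.2

/-- The linear operator `K_1`. -/
def bornLin (α₀ t : ℝ) (η : V → ℂ) : R × S → ℂ := bornOp Γ V R S α₀ t 1 fun _ => η

/-- The operators `𝒦_j` of the inverse Born series with first operator `𝒦_1 = T`:
`𝒦_j = -(∑_{m<j} 𝒦_m ∑_{i₁+⋯+i_m=j} K_{i₁} ⊗ ⋯ ⊗ K_{i_m}) T ⊗ ⋯ ⊗ T` for `j ≥ 2`, where the inner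
sums run over the compositions `c = (i₁, …, i_m)` of `j` into `m = c.length < j` positive parts and
`c.embedding i` lists the arguments in the `i`-th block. (There is no `𝒦_0`; it is set to `0`.) -/
def inverseBornOp (α₀ t : ℝ) (T : (R × S → ℂ) → (V → ℂ)) :
    (j : ℕ) → (Fin j → R × S → ℂ) → V → ℂ
  | 0, _ => 0
  | 1, Φ => T (Φ 0)
  | j + 2, Φ =>
      -∑ c : {c : Composition (j + 2) // c.length < j + 2},
        inverseBornOp α₀ t T c.1.length fun i =>
          bornOp Γ V R S α₀ t (c.1.blocksFun i) fun l => T (Φ (c.1.embedding i l))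
  termination_by j => j
  decreasing_by exact c.2

/-- The `m`-th term `𝒦_m(φ, …, φ)` of the inverse Born series, where `𝒦_1 = K_1⁻¹`
(`Function.invFun` is the two-sided inverse whenever `K_1` is bijective). -/
def inverseBornTerm (α₀ t : ℝ) (m : ℕ) (φ : R × S → ℂ) : V → ℂ :=
  inverseBornOp Γ V R S α₀ t (Function.invFun (bornLin Γ V R S α₀ t)) m fun _ => φ

/-- The sum `ψ(φ) = ∑_{m ≥ 1} 𝒦_m(φ, …, φ)` of the inverse Born series. -/
def inverseBornSum (α₀ t : ℝ) (φ : R × S → ℂ) : V → ℂ :=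
  ∑' m : ℕ, inverseBornTerm Γ V R S α₀ t m φ

/-- `ν_p = α₀ ‖G₀^{R;V}‖_{ℓ^q(V) × ℓ^p(R)} ‖G₀^{V;S}‖_{ℓ^q(V) × ℓ^p(S)}` (mixed norms: `ℓ^q` in the
variable in `V`, then `ℓ^p` in the other one). -/
def nu (α₀ t : ℝ) (p q : ℝ≥0∞) : ℝ :=
  α₀ * lpNorm p (fun r : R => lpNorm q fun v : V => greenRV Γ V R α₀ t r v) *
    lpNorm p (fun s : S => lpNorm q fun v : V => greenVS Γ V S α₀ t v s)

/-- `μ_p = α₀ max_{v ∈ V} ‖G₀^{V;v}‖_{ℓ^q(V)}`. -/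
def mu (α₀ t : ℝ) (q : ℝ≥0∞) : ℝ :=
  α₀ * ⨆ v : V, lpNorm q fun w : V => greenVV Γ V α₀ t w v

/-- `C_p = min_{‖η‖_p = 1} ‖K_1 η‖_p`. -/
def minGain (α₀ t : ℝ) (p : ℝ≥0∞) : ℝ :=
  sInf {c : ℝ | ∃ η : V → ℂ, lpNorm p η = 1 ∧ c = lpNorm p (bornLin Γ V R S α₀ t η)}

/-- The radius of convergence
`r_p = (C_p / μ_p) (1 - 2 (ν_p / C_p) (√(1 + C_p / ν_p) - 1))`. -/
def radius (α₀ t : ℝ) (p q : ℝ≥0∞) : ℝ :=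
  minGain Γ V R S α₀ t p / mu Γ V α₀ t q *
    (1 - 2 * (nu Γ V R S α₀ t p q / minGain Γ V R S α₀ t p) *
      (√(1 + minGain Γ V R S α₀ t p / nu Γ V R S α₀ t p q) - 1))

/-- The radius `ρ_p = (1 / μ_p) (1 - √(ν_p / (C_p + ν_p)))` of the ball of potentials in which
every `φ` with `‖φ‖_p < r_p` determines the potential uniquely. -/
def potentialRadius (α₀ t : ℝ) (p q : ℝ≥0∞) : ℝ :=
  1 / mu Γ V α₀ t q *
    (1 - √(nu Γ V R S α₀ t p q / (minGain Γ V R S α₀ t p + nu Γ V R S α₀ t p q)))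

/-- The set of the values `‖ψ(φ)‖_p`, for complex `φ` with `‖φ‖_p < r_p`. -/
def inverseBornNorms (α₀ t : ℝ) (p q : ℝ≥0∞) : Set ℝ :=
  {a | ∃ φ : R × S → ℂ, lpNorm p φ < radius Γ V R S α₀ t p q ∧
    a = lpNorm p (inverseBornSum Γ V R S α₀ t φ)}

end Graph

end GraphOT

end

noncomputable section

namespace GraphOT

open Finset Filter Topology FormalMultilinearSeries

/-! ### Inversion of formal multilinear series by majorants -/

section AbstractInversion

variable {E F : Type*} [NormedAddCommGroup E] [NormedSpace ℂ E] [NormedAddCommGroup F]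
  [NormedSpace ℂ F]

/-! The Born series is a formal power series with `‖K_j‖ ≤ ν μ^(j-1)` whose linear part satisfies
`‖K_1 η‖ ≥ C ‖η‖`, and the inverse Born operators are the coefficients of its formal inverse
(`ofLp_leftInv_bornSeries`). Everything is governed by the scalar majorant `h(a) = C a - (ν/μ) (μ
a)²/(1 - μ a)`, whose critical point is `ρ_p` and whose value there is `r_p`.

Whenever `y ≤ h(a)`, the norms of the inverse coefficients satisfy `∑ y^k ‖𝒦_k‖ ≤ a`
(`sum_norm_rightInv_le`). With `a = ρ_p` this gives convergence for `‖φ‖ < r_p` and `‖ψ(φ)‖ ≤ ρ_p`,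
so `M` is finite. The forward sum composed with `ψ` is the identity near `0`, hence on the whole
ball by the identity theorem (`sum_sum_rightInv`). Below `ρ_p` the linear part dominates the
Lipschitz constant of the rest, so the forward sum is injective there (`eq_of_sum_eq_sum`). Together
these give `ψ(φ_η) = η` for `‖η‖ < ρ_p` and `‖φ_η‖ < r_p` (`sum_rightInv_sum`).

The resolvent identity shows that the forward sum is the true scattering data
(`tendsto_sum_bornOp`). For nonnegative `η` the maximum principle makes the data monotone in `η`. If
`‖η‖ ≥ ρ_p`, shrinking `η` to norm `ρ_p` would give smaller data that still have norm at least
`h(ρ_p) = r_p`; so small data force `‖η‖ < ρ_p`.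

Finally, Cauchy's estimate on complex lines gives `‖𝒦_m(φ, …, φ)‖ ≤ M (‖φ‖/r_p)^m`. The resulting
geometric tail is below the asserted bound. -/

/-- The majorant `h(a) = C a - D (μ a)² / (1 - μ a)` of the forward series. -/
def majorant (C D μ a : ℝ) : ℝ := C * a - D * ((μ * a) ^ 2 / (1 - μ * a))

theorem mem_eball_zero_ofReal_iff {G : Type*} [NormedAddCommGroup G] {y : G} {r : ℝ} :
    y ∈ Metric.eball (0 : G) (ENNReal.ofReal r) ↔ ‖y‖ < r := by
  rw [Metric.eball_ofReal, mem_ball_zero_iff]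

/-- No convergence has to be assumed: a non-summable series has sum `0` by convention. -/
theorem norm_sum_le_of_sum_norm_le {p : FormalMultilinearSeries ℂ E F}
    {x : E} {a : ℝ} (ha : 0 ≤ a)
    (h : ∀ n, ∑ k ∈ range n, ‖x‖ ^ k * ‖p k‖ ≤ a) : ‖p.sum x‖ ≤ a := by
  by_cases hs : Summable fun n : ℕ => p n fun _ => x
  · refine le_of_tendsto hs.hasSum.tendsto_sum_nat.norm (Eventually.of_forall fun n => ?_)
    refine (norm_sum_le _ _).trans (le_trans (sum_le_sum fun k _ => ?_) (h n))
    simpa [mul_comm] using (p k).le_opNorm fun _ => x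
  · rw [FormalMultilinearSeries.sum, tsum_eq_zero_of_not_summable hs]
    simpa using ha

/-- Majorant bound for the coefficients of the inverse of a formal multilinear series. -/
theorem sum_norm_rightInv_le (p : FormalMultilinearSeries ℂ E F) (i : E ≃L[ℂ] F)
    {C D μ a y : ℝ} (hC : 0 < C) (hD : 0 ≤ D) (hμ : 0 ≤ μ) (hp : ∀ n, ‖p n‖ ≤ D * μ ^ n)
    (hi : ‖(i.symm : F →L[ℂ] E)‖ ≤ C⁻¹) (ha : 0 ≤ a) (hμa : μ * a < 1) (hy : 0 ≤ y)
    (hya : y ≤ majorant C D μ a) (n : ℕ) :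
    ∑ k ∈ range n, y ^ k * ‖p.rightInv i 0 k‖ ≤ a := by
  have key : ∀ n, ∑ k ∈ Ico 1 (n + 1), y ^ k * ‖p.rightInv i 0 k‖ ≤ a := by
    intro n
    induction n with
    | zero => simpa using ha
    | succ n ih =>
      -- The partial sums obey `S_{n+1} ≤ C⁻¹ (y + D ∑_{k ≥ 2} (μ S_n)^k)`, a finite sum. The
      -- hypothesis `y ≤ h(a)` says that `a` is a supersolution of this recursion, so `S_n ≤ a`
      -- propagates.
      refine (radius_rightInv_pos_of_radius_pos_aux2 (by lia) p i hμ hy hD hp).trans ?_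
      have h0 : 0 ≤ ∑ k ∈ Ico 1 (n + 1), y ^ k * ‖p.rightInv i 0 k‖ :=
        sum_nonneg fun k _ => by positivity
      have hgeom : ∑ k ∈ Ico 2 (n + 1 + 1),
          (μ * ∑ k ∈ Ico 1 (n + 1), y ^ k * ‖p.rightInv i 0 k‖) ^ k ≤
            (μ * a) ^ 2 / (1 - μ * a) :=
        (sum_le_sum fun k _ => by gcongr).trans
          (geom_sum_Ico_le_of_lt_one (by positivity) hμa)
      have h1 : 0 ≤ (μ * a) ^ 2 / (1 - μ * a) :=
        div_nonneg (sq_nonneg _) (by linarith)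
      calc _ ≤ C⁻¹ * y + C⁻¹ * D * ((μ * a) ^ 2 / (1 - μ * a)) := by gcongr
        _ = C⁻¹ * (y + D * ((μ * a) ^ 2 / (1 - μ * a))) := by ring
        _ ≤ C⁻¹ * (C * a) := by
          gcongr
          unfold majorant at hya
          linarith
        _ = a := by field_simp
  rcases n with _ | n
  · simpa using ha
  · rw [range_eq_Ico, sum_eq_sum_Ico_succ_bot (by lia)]
    simpa [rightInv_coeff_zero] using key n

theorem le_radius_rightInv (p : FormalMultilinearSeries ℂ E F) (i : E ≃L[ℂ] F)
    {C D μ a : ℝ} (hC : 0 < C) (hD : 0 ≤ D) (hμ : 0 ≤ μ) (hp : ∀ n, ‖p n‖ ≤ D * μ ^ n)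
    (hi : ‖(i.symm : F →L[ℂ] E)‖ ≤ C⁻¹) (ha : 0 ≤ a) (hμa : μ * a < 1) :
    ENNReal.ofReal (majorant C D μ a) ≤ (p.rightInv i 0).radius := by
  by_cases h0 : 0 ≤ majorant C D μ a
  · refine le_radius_of_bound _ a fun n => ?_
    rw [Real.coe_toNNReal _ h0, mul_comm]
    refine le_trans ?_ (sum_norm_rightInv_le p i hC hD hμ hp hi ha hμa h0 le_rfl (n + 1))
    exact single_le_sum (f := fun k => majorant C D μ a ^ k * ‖p.rightInv i 0 k‖)
      (fun k _ => by positivity) (self_mem_range_succ n)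
  · rw [ENNReal.ofReal_of_nonpos (le_of_not_ge h0)]
    exact zero_le

theorem norm_sum_rightInv_le (p : FormalMultilinearSeries ℂ E F) (i : E ≃L[ℂ] F)
    {C D μ a : ℝ} (hC : 0 < C) (hD : 0 ≤ D) (hμ : 0 ≤ μ) (hp : ∀ n, ‖p n‖ ≤ D * μ ^ n)
    (hi : ‖(i.symm : F →L[ℂ] E)‖ ≤ C⁻¹) (ha : 0 ≤ a) (hμa : μ * a < 1) {y : F}
    (hya : ‖y‖ ≤ majorant C D μ a) : ‖(p.rightInv i 0).sum y‖ ≤ a :=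
  norm_sum_le_of_sum_norm_le ha fun n =>
    sum_norm_rightInv_le p i hC hD hμ hp hi ha hμa (norm_nonneg y) hya n

theorem inv_le_radius (p : FormalMultilinearSeries ℂ E F) {D μ : ℝ} (hμ : 0 < μ)
    (hp : ∀ n, ‖p n‖ ≤ D * μ ^ n) : ENNReal.ofReal μ⁻¹ ≤ p.radius := by
  refine le_radius_of_bound _ D fun n => ?_
  rw [Real.coe_toNNReal _ (by positivity)]
  calc _ ≤ D * μ ^ n * μ⁻¹ ^ n := by gcongr; exact hp n
    _ = D := by rw [mul_assoc, ← mul_pow, mul_inv_cancel₀ hμ.ne', one_pow, mul_one]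

theorem hasFPowerSeriesOnBall_sum [CompleteSpace F] (p : FormalMultilinearSeries ℂ E F)
    {D μ : ℝ} (hμ : 0 < μ) (hp : ∀ n, ‖p n‖ ≤ D * μ ^ n) :
    HasFPowerSeriesOnBall p.sum p 0 (ENNReal.ofReal μ⁻¹) := by
  have hpos : 0 < ENNReal.ofReal μ⁻¹ := by simpa using hμ
  have hle := inv_le_radius p hμ hp
  exact (p.hasFPowerSeriesOnBall (hpos.trans_le hle)).mono hpos hle

theorem hasFPowerSeriesOnBall_sum_rightInv [CompleteSpace E] (p : FormalMultilinearSeries ℂ E F)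
    (i : E ≃L[ℂ] F) {C D μ a : ℝ} (hC : 0 < C) (hD : 0 ≤ D) (hμ : 0 ≤ μ)
    (hp : ∀ n, ‖p n‖ ≤ D * μ ^ n) (hi : ‖(i.symm : F →L[ℂ] E)‖ ≤ C⁻¹) (ha : 0 ≤ a)
    (hμa : μ * a < 1) (hpos : 0 < majorant C D μ a) :
    HasFPowerSeriesOnBall (p.rightInv i 0).sum (p.rightInv i 0) 0
      (ENNReal.ofReal (majorant C D μ a)) := by
  have hpos' : 0 < ENNReal.ofReal (majorant C D μ a) := by simpa using hpos
  have hle := le_radius_rightInv p i hC hD hμ hp hi ha hμa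
  exact ((p.rightInv i 0).hasFPowerSeriesOnBall (hpos'.trans_le hle)).mono hpos' hle

/-- The inverse series inverts the forward series on the whole ball where it converges. -/
theorem sum_sum_rightInv [CompleteSpace E] [CompleteSpace F] (p : FormalMultilinearSeries ℂ E F)
    (i : E ≃L[ℂ] F) (h1 : p 1 = (continuousMultilinearCurryFin1 ℂ E F).symm i) (h0 : p 0 = 0)
    {C D μ a : ℝ} (hC : 0 < C) (hD : 0 ≤ D) (hμ : 0 < μ)
    (hp : ∀ n, ‖p n‖ ≤ D * μ ^ n) (hi : ‖(i.symm : F →L[ℂ] E)‖ ≤ C⁻¹) (ha : 0 ≤ a)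
    (hμa : μ * a < 1) {y : F} (hya : ‖y‖ < majorant C D μ a) :
    p.sum ((p.rightInv i 0).sum y) = y := by
  have hpos : 0 < majorant C D μ a := (norm_nonneg y).trans_lt hya
  have hq := hasFPowerSeriesOnBall_sum_rightInv p i hC hD hμ.le hp hi ha hμa hpos
  have hps := hasFPowerSeriesOnBall_sum p hμ hp
  -- The inverse sum has norm at most `a < 1/μ`, so the composite is analytic on the whole ball; the
  -- formal identity `p ∘ q = id` holds near `0` and spreads by the identity theorem.
  have hmaps : Set.MapsTo (p.rightInv i 0).sum
      (Metric.eball 0 (ENNReal.ofReal (majorant C D μ a)))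
      (Metric.eball 0 (ENNReal.ofReal μ⁻¹)) := fun z hz => by
    rw [mem_eball_zero_ofReal_iff] at hz ⊢
    refine (norm_sum_rightInv_le p i hC hD hμ.le hp hi ha hμa hz.le).trans_lt ?_
    rwa [← one_div, lt_div_iff₀' hμ]
  have hq0 : (p.rightInv i 0).sum 0 = 0 := by
    have := hq.coeff_zero fun _ => (0 : F)
    rw [← this, rightInv_coeff_zero]
    simp
  have hcomp : HasFPowerSeriesAt (p.sum ∘ (p.rightInv i 0).sum) (id ℂ F 0) 0 := by
    have := HasFPowerSeriesAt.comp (f := (p.rightInv i 0).sum) (g := p.sum) (x := 0)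
      (by rw [hq0]; exact hps.hasFPowerSeriesAt) hq.hasFPowerSeriesAt
    rwa [comp_rightInv p i 0 h1, h0] at this
  have hid : HasFPowerSeriesAt (fun y : F => y) (id ℂ F 0) 0 :=
    (ContinuousLinearMap.id ℂ F).hasFPowerSeriesAt 0
  have heq : p.sum ∘ (p.rightInv i 0).sum =ᶠ[𝓝 0] fun y => y := by
    filter_upwards [hcomp.eventually_hasSum, hid.eventually_hasSum] with y h1 h2
    simpa using h1.unique h2
  exact AnalyticOnNhd.eqOn_of_preconnected_of_eventuallyEq
    (hps.analyticOnNhd.comp hq.analyticOnNhd hmaps) (fun x _ => analyticAt_id)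
    (Metric.isPreconnected_eball) (by simpa using hpos) heq
    (mem_eball_zero_ofReal_iff.2 hya)

theorem hasSum_tail [CompleteSpace F] (p : FormalMultilinearSeries ℂ E F) (i : E ≃L[ℂ] F)
    (h1 : p 1 = (continuousMultilinearCurryFin1 ℂ E F).symm i) (h0 : p 0 = 0)
    {D μ : ℝ} (hμ : 0 < μ) (hp : ∀ n, ‖p n‖ ≤ D * μ ^ n) {x : E} (hx : μ * ‖x‖ < 1) :
    HasSum (fun n : ℕ => p (n + 2) fun _ => x) (p.sum x - i x) := by
  have hmem : x ∈ Metric.eball (0 : E) (ENNReal.ofReal μ⁻¹) := by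
    rw [mem_eball_zero_ofReal_iff, ← one_div]
    rwa [lt_div_iff₀' hμ]
  have := (hasFPowerSeriesOnBall_sum p hμ hp).hasSum hmem
  rw [zero_add, ← hasSum_nat_add_iff' 2] at this
  simpa [sum_range_succ, h0, h1] using this

/-- The linear part has norm at least `C ‖x‖`, and the terms of degree at least two are dominated by
a geometric series. -/
theorem majorant_le_norm_sum [CompleteSpace F] (p : FormalMultilinearSeries ℂ E F)
    (i : E ≃L[ℂ] F) (h1 : p 1 = (continuousMultilinearCurryFin1 ℂ E F).symm i) (h0 : p 0 = 0)
    {C D μ : ℝ} (hμ : 0 < μ) (hp : ∀ n, ‖p n‖ ≤ D * μ ^ n)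
    (hi : ∀ x, C * ‖x‖ ≤ ‖i x‖) {x : E} (hx : μ * ‖x‖ < 1) :
    majorant C D μ ‖x‖ ≤ ‖p.sum x‖ := by
  have hgeom : HasSum (fun n : ℕ => D * ((μ * ‖x‖) ^ 2 * (μ * ‖x‖) ^ n))
      (D * ((μ * ‖x‖) ^ 2 / (1 - μ * ‖x‖))) := by
    rw [div_eq_mul_inv]
    exact ((hasSum_geometric_of_lt_one (by positivity) hx).mul_left _).mul_left _
  have hle := (hasSum_tail p i h1 h0 hμ hp hx).norm_le_of_bounded hgeom fun n => by
    calc ‖p (n + 2) fun _ => x‖ ≤ ‖p (n + 2)‖ * ‖x‖ ^ (n + 2) := by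
          simpa using (p (n + 2)).le_opNorm fun _ => x
      _ ≤ D * μ ^ (n + 2) * ‖x‖ ^ (n + 2) := by gcongr; exact hp _
      _ = _ := by ring
  have h2 : ‖i x‖ ≤ ‖p.sum x‖ + ‖p.sum x - i x‖ := by
    simpa using norm_sub_le (p.sum x) (p.sum x - i x)
  unfold majorant
  linarith [hi x]

/-- On the ball of radius `a` the terms of degree at least two have Lipschitz constant at most `D
∑_{n ≥ 2} n μ^n a^(n-1) = D μ (1/(1 - μ a)² - 1)`. If this is below the lower bound `C` of the
linear part, two points with the same image must coincide. -/
theorem eq_of_sum_eq_sum [CompleteSpace F] (p : FormalMultilinearSeries ℂ E F)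
    (i : E ≃L[ℂ] F) (h1 : p 1 = (continuousMultilinearCurryFin1 ℂ E F).symm i) (h0 : p 0 = 0)
    {C D μ a : ℝ} (hμ : 0 < μ) (hp : ∀ n, ‖p n‖ ≤ D * μ ^ n)
    (hi : ∀ x, C * ‖x‖ ≤ ‖i x‖) (ha : 0 ≤ a) (hμa : μ * a < 1)
    (hC : D * μ * (1 / (1 - μ * a) ^ 2 - 1) < C) {x z : E} (hx : ‖x‖ ≤ a) (hz : ‖z‖ ≤ a)
    (hxz : p.sum x = p.sum z) : x = z := by
  have hgeom : HasSum (fun n : ℕ => D * μ * (((n : ℝ) + 2) * (μ * a) ^ (n + 1)) * ‖x - z‖)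
      (D * μ * (1 / (1 - μ * a) ^ 2 - 1) * ‖x - z‖) := by
    have := hasSum_choose_mul_geometric_of_norm_lt_one 1 (r := μ * a)
      (by rwa [Real.norm_of_nonneg (by positivity)])
    rw [← hasSum_nat_add_iff' 1] at this
    refine HasSum.mul_right _ (HasSum.mul_left _ ?_)
    convert! this using 2 with n
    · rw [Nat.choose_one_right]; push_cast; ring
    · norm_num
  have hx' : μ * ‖x‖ < 1 := (mul_le_mul_of_nonneg_left hx hμ.le).trans_lt hμa
  have hz' : μ * ‖z‖ < 1 := (mul_le_mul_of_nonneg_left hz hμ.le).trans_lt hμa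
  have hle := ((hasSum_tail p i h1 h0 hμ hp hx').sub
    (hasSum_tail p i h1 h0 hμ hp hz')).norm_le_of_bounded hgeom fun n => by
      have hd : ‖(fun _ : Fin (n + 2) => x) - fun _ => z‖ = ‖x - z‖ :=
        pi_norm_const (ι := Fin (n + 2)) (x - z)
      refine ((p (n + 2)).norm_image_sub_le (fun _ => x) fun _ => z).trans ?_
      rw [hd, pi_norm_const, pi_norm_const, Fintype.card_fin]
      calc _ ≤ D * μ ^ (n + 2) * ((n + 2 : ℕ) : ℝ) * a ^ (n + 2 - 1) * ‖x - z‖ := by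
            gcongr
            · exact mul_nonneg ((norm_nonneg _).trans (hp (n + 2))) (Nat.cast_nonneg _)
            · exact hp _
            · exact max_le hx hz
        _ = _ := by
            rw [show n + 2 - 1 = n + 1 by lia]; push_cast; ring
  have h2 : p.sum x - i x - (p.sum z - i z) = - i (x - z) := by
    rw [hxz, map_sub]; abel
  rw [h2, norm_neg] at hle
  by_contra hne
  have hpos : 0 < ‖x - z‖ := norm_pos_iff.2 (sub_ne_zero.2 hne)
  exact absurd ((hi (x - z)).trans hle) (not_le.2 (mul_lt_mul_of_pos_right hC hpos))

/-- Cauchy's estimate for the homogeneous parts of a bounded analytic function on a ball. -/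
theorem norm_coeff_le_of_forall_norm_lt [CompleteSpace E] {f : F → E}
    {q : FormalMultilinearSeries ℂ F E} {r M : ℝ}
    (hf : HasFPowerSeriesOnBall f q 0 (ENNReal.ofReal r)) (hM : ∀ y, ‖y‖ < r → ‖f y‖ ≤ M)
    (y : F) (n : ℕ) : ‖q n fun _ => y‖ ≤ M * (‖y‖ / r) ^ n := by
  have hr : 0 < r := by simpa using hf.r_pos
  have hM0 : 0 ≤ M := (norm_nonneg _).trans (hM 0 (by simpa using hr))
  -- Restricting to the complex line through `y` reduces to the one-variable estimate on circles of
  -- radius `R` with `R ‖y‖ < r`; then `R` tends to `r / ‖y‖`.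
  let L : ℂ →L[ℂ] F := (ContinuousLinearMap.id ℂ ℂ).smulRight y
  have hL : ∀ z, L z = z • y := fun z => rfl
  have hg : HasFPowerSeriesAt (f ∘ L) (q.compContinuousLinearMap L) 0 :=
    HasFPowerSeriesAt.compContinuousLinearMap (by simpa [hL] using hf.hasFPowerSeriesAt)
  have hcoeff : ∀ R : ℝ, 0 < R → R * ‖y‖ < r → ‖q n fun _ => y‖ ≤ M / R ^ n := by
    intro R hR hRy
    have hmem : ∀ z : ℂ, ‖z‖ ≤ R → ‖L z‖ < r := fun z hz => by
      rw [hL, norm_smul]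
      exact (mul_le_mul_of_nonneg_right hz (norm_nonneg y)).trans_lt hRy
    have hdiff : DifferentiableOn ℂ (f ∘ L) (Metric.closedBall 0 R) := fun z hz => by
      have h1 : AnalyticAt ℂ f (L z) := hf.analyticAt_of_mem
        (mem_eball_zero_ofReal_iff.2 (hmem z (by simpa using hz)))
      exact (h1.differentiableAt.comp z L.differentiableAt).differentiableWithinAt
    have hcauchy := Complex.norm_iteratedDeriv_le_of_forall_mem_sphere_norm_le n hR
      (DifferentiableOn.diffContOnCl_ball hdiff subset_rfl)
      (C := M) (c := 0) (f := f ∘ L) fun z hz => hM _ (hmem z (by simpa using hz.le))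
    have hder : iteratedDeriv n (f ∘ L) 0 = (n.factorial : ℂ) • q n fun _ => y := by
      obtain ⟨r', hr'⟩ := hg
      have := hr'.factorial_smul (1 : ℂ) n
      rw [iteratedDeriv_eq_iteratedFDeriv, ← this]
      rw [compContinuousLinearMap_apply, show L ∘ (fun _ : Fin n => (1 : ℂ)) = fun _ => y from
        funext fun _ => one_smul ℂ y, Nat.cast_smul_eq_nsmul]
    rw [hder, norm_smul, mul_div_assoc, Complex.norm_natCast] at hcauchy
    exact le_of_mul_le_mul_left hcauchy (by positivity)
  rcases eq_or_ne y 0 with rfl | hy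
  · rcases n with _ | n
    · simpa using hcoeff 1 one_pos (by simpa using hr)
    · have : (q (n + 1) fun _ => (0 : F)) = 0 := (q (n + 1)).map_coord_zero 0 rfl
      simp [this]
  · have hy' : 0 < ‖y‖ := norm_pos_iff.2 hy
    have hlim : Tendsto (fun R : ℝ => M / R ^ n) (𝓝[<] (r / ‖y‖)) (𝓝 (M / (r / ‖y‖) ^ n)) := by
      refine (ContinuousAt.tendsto ?_).mono_left nhdsWithin_le_nhds
      exact continuousAt_const.div (by fun_prop) (by positivity)
    have hle : ‖q n fun _ => y‖ ≤ M / (r / ‖y‖) ^ n := by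
      refine ge_of_tendsto hlim ?_
      filter_upwards [Ioo_mem_nhdsLT (show (0 : ℝ) < r / ‖y‖ by positivity)] with R hR
      exact hcoeff R hR.1 ((lt_div_iff₀ hy').1 hR.2)
    calc _ ≤ M / (r / ‖y‖) ^ n := hle
      _ = M * (‖y‖ / r) ^ n := by rw [div_eq_mul_inv, ← inv_pow, inv_div]

/-- Geometric bound for the remainder of a bounded power series. -/
theorem norm_sub_sum_Icc_le [CompleteSpace E] {f : F → E}
    {q : FormalMultilinearSeries ℂ F E} {r M : ℝ}
    (hf : HasFPowerSeriesOnBall f q 0 (ENNReal.ofReal r)) (hM : ∀ y, ‖y‖ < r → ‖f y‖ ≤ M)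
    (hq0 : q 0 = 0) {y : F} (hy : ‖y‖ < r) (N : ℕ) :
    ‖f y - ∑ m ∈ Icc 1 N, q m fun _ => y‖ ≤ M * ((‖y‖ / r) ^ (N + 1) / (1 - ‖y‖ / r)) := by
  have hr : 0 < r := (norm_nonneg y).trans_lt hy
  have hsum := hf.hasSum (mem_eball_zero_ofReal_iff.2 hy)
  rw [zero_add, ← hasSum_nat_add_iff' (N + 1)] at hsum
  have hIcc : ∑ m ∈ range (N + 1), (q m fun _ => y) = ∑ m ∈ Icc 1 N, q m fun _ => y := by
    rw [range_eq_Ico, sum_eq_sum_Ico_succ_bot (by lia), hq0]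
    simp [Ico_add_one_right_eq_Icc]
  rw [hIcc] at hsum
  refine hsum.norm_le_of_bounded (g := fun n => M * ((‖y‖ / r) ^ (N + 1) * (‖y‖ / r) ^ n)) ?_
    fun n => ?_
  · rw [div_eq_mul_inv ((‖y‖ / r) ^ (N + 1))]
    exact ((hasSum_geometric_of_lt_one (by positivity) ((div_lt_one hr).2 hy)).mul_left _).mul_left _
  · rw [← pow_add, add_comm (N + 1)]
    exact norm_coeff_le_of_forall_norm_lt hf hM y _

end AbstractInversion

end GraphOT

end

noncomputable section

namespace GraphOT

open Finset

/-! ### Finite `ℓ^p` norms and Hölder's inequality -/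

section LpNorm

variable {ι κ E E' : Type*} [Fintype ι] [Fintype κ] [NormedAddCommGroup E] [NormedAddCommGroup E']
  {p q : ℝ≥0∞}

theorem lpNorm_one (x : ι → E) : lpNorm 1 x = ∑ i, ‖x i‖ := PiLp.norm_eq_of_L1 _

theorem lpNorm_top (x : ι → E) : lpNorm ⊤ x = ‖x‖ := PiLp.norm_toLp _

theorem lpNorm_eq_sum (hp : 0 < p.toReal) (x : ι → E) :
    lpNorm p x = (∑ i, ‖x i‖ ^ p.toReal) ^ (1 / p.toReal) := PiLp.norm_eq_sum hp _

theorem lpNorm_nonneg (hp : 1 ≤ p) (x : ι → E) : 0 ≤ lpNorm p x :=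
  haveI : Fact (1 ≤ p) := ⟨hp⟩
  norm_nonneg _

theorem norm_le_lpNorm (hp : 1 ≤ p) (x : ι → E) (i : ι) : ‖x i‖ ≤ lpNorm p x :=
  haveI : Fact (1 ≤ p) := ⟨hp⟩
  PiLp.norm_apply_le (WithLp.toLp p x) i

theorem lpNorm_top_le (hp : 1 ≤ p) (x : ι → E) : lpNorm ⊤ x ≤ lpNorm p x := by
  rw [lpNorm_top]
  exact (pi_norm_le_iff_of_nonneg (lpNorm_nonneg hp x)).2 (norm_le_lpNorm hp x)

theorem eq_top_or_toReal_pos (hp : 1 ≤ p) : p = ⊤ ∨ 0 < p.toReal := by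
  rcases eq_or_ne p ⊤ with h | h
  · exact Or.inl h
  · exact Or.inr (ENNReal.toReal_pos (zero_lt_one.trans_le hp).ne' h)

theorem lpNorm_mono (hp : 1 ≤ p) {x : ι → E} {y : ι → E'} (h : ∀ i, ‖x i‖ ≤ ‖y i‖) :
    lpNorm p x ≤ lpNorm p y := by
  rcases eq_top_or_toReal_pos hp with rfl | hp'
  · rw [lpNorm_top, lpNorm_top]
    exact (pi_norm_le_iff_of_nonneg (norm_nonneg y)).2 fun i => (h i).trans (norm_le_pi_norm y i)
  · rw [lpNorm_eq_sum hp', lpNorm_eq_sum hp']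
    gcongr with i
    exact h i

theorem lpNorm_prod_mul_le (hp : 1 ≤ p) (A : ι → ℝ) (B : κ → ℝ) :
    lpNorm p (fun x : ι × κ => A x.1 * B x.2) ≤ lpNorm p A * lpNorm p B := by
  rcases eq_top_or_toReal_pos hp with rfl | hp'
  · simp only [lpNorm_top]
    refine (pi_norm_le_iff_of_nonneg (by positivity)).2 fun x => ?_
    rw [norm_mul]
    gcongr
    · exact norm_le_pi_norm A x.1
    · exact norm_le_pi_norm B x.2
  · rw [lpNorm_eq_sum hp', lpNorm_eq_sum hp', lpNorm_eq_sum hp', ← Real.mul_rpow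
      (sum_nonneg fun _ _ => by positivity) (sum_nonneg fun _ _ => by positivity),
      sum_mul_sum, Fintype.sum_prod_type]
    simp only [norm_mul, Real.mul_rpow (norm_nonneg _) (norm_nonneg _)]
    rfl

theorem lpNorm_const_mul (hp : 1 ≤ p) (c : ℝ) (A : ι → ℝ) :
    lpNorm p (fun i => c * A i) = |c| * lpNorm p A :=
  haveI : Fact (1 ≤ p) := ⟨hp⟩
  norm_smul c (WithLp.toLp p A)

/-- **Hölder's inequality** for finite families. -/
theorem sum_norm_mul_norm_le (hpq : p⁻¹ + q⁻¹ = 1) (x : ι → E) (y : ι → E') :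
    ∑ i, ‖x i‖ * ‖y i‖ ≤ lpNorm p x * lpNorm q y := by
  rcases eq_or_ne p ⊤ with rfl | hp
  · have hq : q = 1 := by simpa using hpq
    subst hq
    rw [lpNorm_one, lpNorm_top, mul_sum]
    gcongr with i
    exact norm_le_pi_norm x i
  rcases eq_or_ne q ⊤ with rfl | hq
  · have hp : p = 1 := by simpa using hpq
    subst hp
    rw [lpNorm_one, lpNorm_top, sum_mul]
    gcongr with i
    exact norm_le_pi_norm y i
  have hp1 : 1 ≤ p := by
    rw [← ENNReal.inv_le_one, ← hpq]; exact le_self_add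
  have hq1 : 1 ≤ q := by
    rw [← ENNReal.inv_le_one, ← hpq]; exact le_add_self
  have hp0 : 0 < p.toReal := (eq_top_or_toReal_pos hp1).resolve_left hp
  have hq0 : 0 < q.toReal := (eq_top_or_toReal_pos hq1).resolve_left hq
  have hconj : p.toReal.HolderConjugate q.toReal := by
    refine ⟨?_, hp0, hq0⟩
    rw [← ENNReal.toReal_inv, ← ENNReal.toReal_inv, ← ENNReal.toReal_add, hpq] <;> simp
    · exact (zero_lt_one.trans_le hp1).ne'
    · exact (zero_lt_one.trans_le hq1).ne'
  rw [lpNorm_eq_sum hp0, lpNorm_eq_sum hq0]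
  exact Real.inner_le_Lp_mul_Lq_of_nonneg univ hconj (fun _ _ => norm_nonneg _)
    fun _ _ => norm_nonneg _

end LpNorm

/-! ### Norm bounds for products of diagonal matrices and Green blocks -/

section Matrix

variable {ι : Type*} [Fintype ι] {p q : ℝ≥0∞}

theorem norm_dotProduct_le {x y : ι → ℂ} {c : ℝ} (h : ∀ i, ‖x i‖ ≤ c) :
    ‖x ⬝ᵥ y‖ ≤ c * ∑ i, ‖y i‖ := by
  rw [mul_sum]
  refine (norm_sum_le _ _).trans (sum_le_sum fun i _ => ?_)
  rw [norm_mul]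
  gcongr
  exact h i

variable [DecidableEq ι]

theorem sum_norm_diagonal_mulVec_le (hpq : p⁻¹ + q⁻¹ = 1) (η x : ι → ℂ) :
    ∑ i, ‖(Matrix.diagonal η).mulVec x i‖ ≤ lpNorm p η * lpNorm q x := by
  simpa [Matrix.mulVec_diagonal] using sum_norm_mul_norm_le hpq η x

/-- `G` maps `ℓ^1` to `ℓ^q` with norm controlled by its columns, and by Hölder `D_η` maps `ℓ^q` back
to `ℓ^1`. Being a bound on `ℓ^1` alone, it can be iterated. -/
theorem sum_norm_diagonal_mul_mulVec_le (hpq : p⁻¹ + q⁻¹ = 1) (hp : 1 ≤ p) (η x : ι → ℂ)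
    (G : Matrix ι ι ℂ) {c : ℝ} (hG : ∀ v, lpNorm q (fun w => G w v) ≤ c) :
    ∑ i, ‖(Matrix.diagonal η * G).mulVec x i‖ ≤ (lpNorm p η * c) * ∑ i, ‖x i‖ := by
  calc ∑ i, ‖(Matrix.diagonal η * G).mulVec x i‖
      ≤ ∑ i, ∑ v, ‖x v‖ * (‖η i‖ * ‖G i v‖) := by
        refine sum_le_sum fun i _ => (norm_sum_le _ _).trans (sum_le_sum fun v _ => ?_)
        dsimp only
        rw [Matrix.diagonal_mul, norm_mul, norm_mul, mul_comm]
    _ = ∑ v, ‖x v‖ * ∑ i, ‖η i‖ * ‖G i v‖ := by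
        rw [sum_comm]; simp_rw [mul_sum]
    _ ≤ ∑ v, ‖x v‖ * (lpNorm p η * c) := by
        gcongr with v
        exact (sum_norm_mul_norm_le hpq η fun w => G w v).trans
          (mul_le_mul_of_nonneg_left (hG v) (lpNorm_nonneg hp η))
    _ = _ := by rw [← sum_mul, mul_comm]

theorem sum_norm_ofFn_prod_mulVec_le (hpq : p⁻¹ + q⁻¹ = 1) (hp : 1 ≤ p)
    (G : Matrix ι ι ℂ) {c : ℝ} (hc : 0 ≤ c) (hG : ∀ v, lpNorm q (fun w => G w v) ≤ c) (x : ι → ℂ) :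
    ∀ (k : ℕ) (η : Fin k → ι → ℂ),
      ∑ i, ‖((List.ofFn fun j => Matrix.diagonal (η j) * G).prod).mulVec x i‖ ≤
        (∏ j, lpNorm p (η j) * c) * ∑ i, ‖x i‖
  | 0, η => by simp
  | k + 1, η => by
    rw [List.ofFn_succ, List.prod_cons, ← Matrix.mulVec_mulVec, Fin.prod_univ_succ, mul_assoc]
    refine (sum_norm_diagonal_mul_mulVec_le hpq hp _ _ G hG).trans ?_
    exact mul_le_mul_of_nonneg_left (sum_norm_ofFn_prod_mulVec_le hpq hp G hc hG x k _)
      (mul_nonneg (lpNorm_nonneg hp _) hc)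

theorem mul_mul_diagonal_mul_apply {ρ σ : Type*} (A : Matrix ρ ι ℂ) (P : Matrix ι ι ℂ)
    (d : ι → ℂ) (B : Matrix ι σ ℂ) (r : ρ) (s : σ) :
    (A * P * Matrix.diagonal d * B) r s =
      A r ⬝ᵥ P.mulVec ((Matrix.diagonal d).mulVec fun v => B v s) := by
  rw [Matrix.mulVec_mulVec, Matrix.mul_assoc, Matrix.mul_assoc, ← Matrix.mul_assoc P]
  rfl

/-- The last diagonal factor sends the source column from `ℓ^q` to `ℓ^1`, the `k` middle factors
stay in `ℓ^1`, and the receiver row pairs with `ℓ^1` through its sup norm, which is at most its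
`ℓ^q` norm. -/
theorem norm_mul_ofFn_prod_mul_apply_le (hpq : p⁻¹ + q⁻¹ = 1) (hp : 1 ≤ p) (hq : 1 ≤ q)
    {ρ σ : Type*} (A : Matrix ρ ι ℂ) (B : Matrix ι σ ℂ) (G : Matrix ι ι ℂ) {c : ℝ} (hc : 0 ≤ c)
    (hG : ∀ v, lpNorm q (fun w => G w v) ≤ c) (k : ℕ) (η : Fin (k + 1) → ι → ℂ) (r : ρ) (s : σ) :
    ‖(A * (List.ofFn fun i : Fin k => Matrix.diagonal (η i.castSucc) * G).prod *
        Matrix.diagonal (η (Fin.last k)) * B) r s‖ ≤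
      (∏ i, lpNorm p (η i)) * c ^ k * (lpNorm q (A r) * lpNorm q fun v => B v s) := by
  set P := (List.ofFn fun i : Fin k => Matrix.diagonal (η i.castSucc) * G).prod
  set x := (Matrix.diagonal (η (Fin.last k))).mulVec fun v => B v s
  have h2 := sum_norm_ofFn_prod_mulVec_le hpq hp G hc hG x k fun i => η i.castSucc
  have h3 := sum_norm_diagonal_mulVec_le hpq (η (Fin.last k)) fun v => B v s
  have h4 : 0 ≤ ∏ j : Fin k, lpNorm p (η j.castSucc) * c :=
    prod_nonneg fun i _ => mul_nonneg (lpNorm_nonneg hp _) hc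
  rw [mul_mul_diagonal_mul_apply]
  calc ‖A r ⬝ᵥ P.mulVec x‖ ≤ lpNorm q (A r) * ∑ i, ‖P.mulVec x i‖ :=
        norm_dotProduct_le (norm_le_lpNorm hq _)
    _ ≤ lpNorm q (A r) * ((∏ j : Fin k, lpNorm p (η j.castSucc) * c) *
          (lpNorm p (η (Fin.last k)) * lpNorm q fun v => B v s)) :=
        mul_le_mul_of_nonneg_left (h2.trans (mul_le_mul_of_nonneg_left h3 h4))
          (lpNorm_nonneg hq _)
    _ = _ := by
        rw [prod_mul_distrib, Fin.prod_univ_castSucc, prod_const, card_univ, Fintype.card_fin]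
        ring

end Matrix

/-! ### The Born operators as a formal multilinear series -/

section Born

variable {W : Type*} [Fintype W] [DecidableEq W] (Γ : SimpleGraph W) [DecidableRel Γ.Adj]
  (V : Finset W) (R S : Finset ↥(boundary Γ V)) (α₀ t : ℝ) {p q : ℝ≥0∞}

theorem lpNorm_greenVV_le (hα₀ : 0 < α₀) (v : V) :
    lpNorm q (fun w => greenVV Γ V α₀ t w v) ≤ mu Γ V α₀ t q / α₀ := by
  rw [mu, mul_div_cancel_left₀ _ hα₀.ne']
  exact le_ciSup (f := fun v : V => lpNorm q fun w : V => greenVV Γ V α₀ t w v)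
    (Set.finite_range _).bddAbove v

theorem mu_nonneg (hα₀ : 0 ≤ α₀) (hq : 1 ≤ q) : 0 ≤ mu Γ V α₀ t q :=
  mul_nonneg hα₀ (Real.iSup_nonneg fun _ => lpNorm_nonneg hq _)

theorem nu_nonneg (hα₀ : 0 ≤ α₀) (hp : 1 ≤ p) : 0 ≤ nu Γ V R S α₀ t p q :=
  mul_nonneg (mul_nonneg hα₀ (lpNorm_nonneg hp _)) (lpNorm_nonneg hp _)

/-- The entrywise bound splits as a function of `r` times a function of `s`, so its `ℓ^p` norm on `R
× S` is bounded by a product. Of the `k + 1` factors `α₀`, one goes into `ν_p` and `k` into `μ_p`.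
-/
theorem lpNorm_bornOp_succ_le (hpq : p⁻¹ + q⁻¹ = 1) (hp : 1 ≤ p) (hq : 1 ≤ q) (hα₀ : 0 < α₀)
    (k : ℕ) (η : Fin (k + 1) → V → ℂ) :
    lpNorm p (bornOp Γ V R S α₀ t (k + 1) η) ≤
      nu Γ V R S α₀ t p q * mu Γ V α₀ t q ^ k * ∏ i, lpNorm p (η i) := by
  set A : R → ℝ := fun r => lpNorm q fun v : V => greenRV Γ V R α₀ t r v
  set B : S → ℝ := fun s => lpNorm q fun v : V => greenVS Γ V S α₀ t v s
  have hμ := mu_nonneg (q := q) Γ V α₀ t hα₀.le hq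
  have hη : 0 ≤ ∏ i, lpNorm p (η i) := prod_nonneg fun i _ => lpNorm_nonneg hp _
  have hpt : ∀ x : R × S, ‖bornOp Γ V R S α₀ t (k + 1) η x‖ ≤
      ‖(α₀ * mu Γ V α₀ t q ^ k * ∏ i, lpNorm p (η i)) * (A x.1 * B x.2)‖ := by
    rintro ⟨r, s⟩
    have hA : 0 ≤ A r := lpNorm_nonneg hq _
    have hB : 0 ≤ B s := lpNorm_nonneg hq _
    have h := norm_mul_ofFn_prod_mul_apply_le hpq hp hq (greenRV Γ V R α₀ t) (greenVS Γ V S α₀ t)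
      (greenVV Γ V α₀ t) (div_nonneg hμ hα₀.le) (lpNorm_greenVV_le Γ V α₀ t hα₀) k η r s
    rw [Real.norm_of_nonneg (by positivity), bornOp, norm_mul, norm_neg, norm_pow,
      norm_neg, Complex.norm_of_nonneg hα₀.le]
    refine (mul_le_mul_of_nonneg_left h (by positivity)).trans_eq ?_
    change _ * (_ * (A r * B s)) = _
    rw [div_pow]
    field_simp
    ring
  refine (lpNorm_mono hp hpt).trans ?_
  rw [lpNorm_const_mul hp, abs_of_nonneg (by positivity)]
  calc _ ≤ α₀ * mu Γ V α₀ t q ^ k * (∏ i, lpNorm p (η i)) * (lpNorm p A * lpNorm p B) := by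
        gcongr
        exact lpNorm_prod_mul_le hp A B
    _ = _ := by rw [nu]; ring

/-- The operator `K_{k+1}` as a multilinear map. -/
def bornMultilinear (k : ℕ) : MultilinearMap ℂ (fun _ : Fin (k + 1) => V → ℂ) (R × S → ℂ) :=
  (LinearMap.pi fun rs : R × S => ((-(-(α₀ : ℂ)) ^ (k + 1)) : ℂ) •
    (Matrix.entryLinearMap ℂ ℂ rs.1 rs.2 ∘ₗ
      mulRightLinearMap R ℂ (greenVS Γ V S α₀ t) ∘ₗ
      mulLeftLinearMap V ℂ (greenRV Γ V R α₀ t))).compMultilinearMap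
    ((MultilinearMap.mkPiAlgebraFin ℂ (k + 1) (Matrix V V ℂ)).compLinearMap fun i =>
      -- The last diagonal matrix is followed by the source block, not by `G₀^{V;V}`.
      if i = Fin.last k then Matrix.diagonalLinearMap V ℂ ℂ
      else mulRightLinearMap V ℂ (greenVV Γ V α₀ t) ∘ₗ Matrix.diagonalLinearMap V ℂ ℂ)

theorem bornMultilinear_apply (k : ℕ) (η : Fin (k + 1) → V → ℂ) :
    bornMultilinear Γ V R S α₀ t k η = bornOp Γ V R S α₀ t (k + 1) η := by
  ext rs
  simp only [bornMultilinear, bornOp, LinearMap.compMultilinearMap_apply,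
    MultilinearMap.compLinearMap_apply, MultilinearMap.mkPiAlgebraFin_apply, LinearMap.pi_apply,
    LinearMap.smul_apply, LinearMap.comp_apply, Matrix.entryLinearMap_apply,
    mulRightLinearMap_apply, mulLeftLinearMap_apply, smul_eq_mul]
  rw [List.ofFn_succ', List.concat_eq_append, List.prod_append]
  simp [Fin.castSucc_ne_last, Matrix.mul_assoc]

theorem bornLin_eq_bornMultilinear (η : V → ℂ) :
    bornLin Γ V R S α₀ t η = bornMultilinear Γ V R S α₀ t 0 fun _ => η :=
  (bornMultilinear_apply Γ V R S α₀ t 0 _).symm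

/-- The operator `K_1` as a linear map between `ℓ^p` spaces. -/
def bornLinearMap (p : ℝ≥0∞) : PiLp p (fun _ : V => ℂ) →ₗ[ℂ] PiLp p fun _ : R × S => ℂ where
  toFun x := WithLp.toLp p (bornLin Γ V R S α₀ t x.ofLp)
  map_add' x y := by
    have h := (bornMultilinear Γ V R S α₀ t 0).map_update_add (fun _ => 0) 0 x.ofLp y.ofLp
    have hu : ∀ z : V → ℂ, Function.update (fun _ : Fin 1 => (0 : V → ℂ)) 0 z = fun _ => z :=
      fun z => funext fun i => by rw [Subsingleton.elim i 0, Function.update_self]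
    rw [hu, hu, hu] at h
    simp only [bornLin_eq_bornMultilinear, WithLp.ofLp_add, h, WithLp.toLp_add]
  map_smul' c x := by
    have h := (bornMultilinear Γ V R S α₀ t 0).map_update_smul (fun _ => 0) 0 c x.ofLp
    have hu : ∀ z : V → ℂ, Function.update (fun _ : Fin 1 => (0 : V → ℂ)) 0 z = fun _ => z :=
      fun z => funext fun i => by rw [Subsingleton.elim i 0, Function.update_self]
    rw [hu, hu] at h
    simp only [bornLin_eq_bornMultilinear, WithLp.ofLp_smul, h, WithLp.toLp_smul, RingHom.id_apply]

/-- The operator `K_1` as an isomorphism of normed spaces, when it is bijective. -/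
def bornEquiv (p : ℝ≥0∞) [Fact (1 ≤ p)] (hK : Function.Bijective (bornLin Γ V R S α₀ t)) :
    PiLp p (fun _ : V => ℂ) ≃L[ℂ] PiLp p fun _ : R × S => ℂ :=
  (LinearEquiv.ofBijective (bornLinearMap Γ V R S α₀ t p)
    (((WithLp.toLp_bijective p).comp hK).comp (WithLp.ofLp_bijective p))).toContinuousLinearEquiv

theorem bornEquiv_apply [Fact (1 ≤ p)] (hK : Function.Bijective (bornLin Γ V R S α₀ t))
    (x : PiLp p fun _ : V => ℂ) :
    bornEquiv Γ V R S α₀ t p hK x = WithLp.toLp p (bornLin Γ V R S α₀ t x.ofLp) := rfl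

theorem ofLp_bornEquiv_symm [Fact (1 ≤ p)] (hK : Function.Bijective (bornLin Γ V R S α₀ t))
    (y : PiLp p fun _ : R × S => ℂ) :
    ((bornEquiv Γ V R S α₀ t p hK).symm y).ofLp =
      Function.invFun (bornLin Γ V R S α₀ t) y.ofLp := by
  obtain ⟨x, rfl⟩ := (bornEquiv Γ V R S α₀ t p hK).surjective y
  rw [ContinuousLinearEquiv.symm_apply_apply, bornEquiv_apply]
  exact (Function.leftInverse_invFun hK.injective x.ofLp).symm

/-- The Born series as a formal multilinear series between `ℓ^p` spaces. -/
def bornSeries [Fact (1 ≤ p)] (hpq : p⁻¹ + q⁻¹ = 1) (hq : 1 ≤ q) (hα₀ : 0 < α₀) :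
    FormalMultilinearSeries ℂ (PiLp p fun _ : V => ℂ) (PiLp p fun _ : R × S => ℂ)
  | 0 => 0
  | k + 1 =>
    ((WithLp.linearEquiv p ℂ (R × S → ℂ)).symm.toLinearMap.compMultilinearMap
      ((bornMultilinear Γ V R S α₀ t k).compLinearMap
        fun _ => (WithLp.linearEquiv p ℂ (V → ℂ)).toLinearMap)).mkContinuous
      (nu Γ V R S α₀ t p q * mu Γ V α₀ t q ^ k) fun x => by
        have h := lpNorm_bornOp_succ_le Γ V R S α₀ t hpq Fact.out hq hα₀ k fun i => (x i).ofLp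
        rwa [← bornMultilinear_apply] at h

theorem bornSeries_apply [Fact (1 ≤ p)] (hpq : p⁻¹ + q⁻¹ = 1) (hq : 1 ≤ q) (hα₀ : 0 < α₀)
    (j : ℕ) (x : Fin j → PiLp p fun _ : V => ℂ) :
    (bornSeries Γ V R S α₀ t hpq hq hα₀ j x).ofLp =
      bornOp Γ V R S α₀ t j fun i => (x i).ofLp := by
  rcases j with _ | k
  · rfl
  · rw [← bornMultilinear_apply]
    rfl

/-- The constant `D = ν/μ` turns `ν μ^(j-1)` into the form `D μ^j` required by the abstract
inversion. -/
theorem norm_bornSeries_le [Fact (1 ≤ p)] (hpq : p⁻¹ + q⁻¹ = 1) (hq : 1 ≤ q) (hα₀ : 0 < α₀)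
    (hμ : 0 < mu Γ V α₀ t q) (j : ℕ) :
    ‖bornSeries Γ V R S α₀ t hpq hq hα₀ j‖ ≤
      nu Γ V R S α₀ t p q / mu Γ V α₀ t q * mu Γ V α₀ t q ^ j := by
  have hν := nu_nonneg (q := q) Γ V R S α₀ t hα₀.le (Fact.out : 1 ≤ p)
  rcases j with _ | k
  · have : bornSeries Γ V R S α₀ t hpq hq hα₀ 0 = 0 := rfl
    rw [this, norm_zero]
    positivity
  · refine ContinuousMultilinearMap.opNorm_le_bound (by positivity) fun x => ?_
    have h := lpNorm_bornOp_succ_le Γ V R S α₀ t hpq Fact.out hq hα₀ k fun i => (x i).ofLp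
    rw [← bornSeries_apply Γ V R S α₀ t hpq hq hα₀] at h
    refine h.trans_eq ?_
    rw [pow_succ']
    field_simp
    rfl

theorem bornSeries_one [Fact (1 ≤ p)] (hpq : p⁻¹ + q⁻¹ = 1) (hq : 1 ≤ q) (hα₀ : 0 < α₀)
    (hK : Function.Bijective (bornLin Γ V R S α₀ t)) :
    bornSeries Γ V R S α₀ t hpq hq hα₀ 1 =
      (continuousMultilinearCurryFin1 ℂ (PiLp p fun _ : V => ℂ) (PiLp p fun _ : R × S => ℂ)).symm
        (bornEquiv Γ V R S α₀ t p hK) := by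
  ext x rs
  rw [bornSeries_apply, continuousMultilinearCurryFin1_symm_apply]
  change _ = bornLin Γ V R S α₀ t (x 0).ofLp rs
  rw [bornLin]
  congr 2
  ext i v
  rw [Subsingleton.elim i 0]

/-- The inverse Born operators are the coefficients of the inverse of the Born series. -/
theorem ofLp_leftInv_bornSeries [Fact (1 ≤ p)] (hpq : p⁻¹ + q⁻¹ = 1) (hq : 1 ≤ q) (hα₀ : 0 < α₀)
    (hK : Function.Bijective (bornLin Γ V R S α₀ t)) (j : ℕ) :
    ∀ y : Fin j → PiLp p fun _ : R × S => ℂ,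
      ((bornSeries Γ V R S α₀ t hpq hq hα₀).leftInv (bornEquiv Γ V R S α₀ t p hK) 0 j y).ofLp =
        inverseBornOp Γ V R S α₀ t (Function.invFun (bornLin Γ V R S α₀ t)) j
          fun l => (y l).ofLp := by
  induction j using Nat.strong_induction_on with | _ j ih
  intro y
  match j with
  | 0 => rw [FormalMultilinearSeries.leftInv_coeff_zero, inverseBornOp]; rfl
  | 1 =>
    rw [FormalMultilinearSeries.leftInv_coeff_one, inverseBornOp,
      continuousMultilinearCurryFin1_symm_apply]
    exact ofLp_bornEquiv_symm Γ V R S α₀ t hK _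
  | j + 2 =>
    -- The recursion for the left inverse runs over the same compositions as the definition of
    -- `𝒦_j`, so the terms match one by one.
    rw [FormalMultilinearSeries.leftInv, inverseBornOp, _root_.neg_apply,
      _root_.sum_apply, WithLp.ofLp_neg, WithLp.ofLp_sum]
    congr 1
    refine sum_congr rfl fun c _ => ?_
    refine (ih c.1.length c.2 _).trans ?_
    congr 1
    ext1 i
    rw [FormalMultilinearSeries.applyComposition,
      FormalMultilinearSeries.compContinuousLinearMap_apply, bornSeries_apply]
    congr 1
    ext1 l
    exact ofLp_bornEquiv_symm Γ V R S α₀ t hK _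

end Born

end GraphOT

end

noncomputable section

namespace GraphOT

/-! ### Green's functions: resolvent identity, positivity, and the Born series -/

section Diffusion

open Finset Filter Topology
open scoped ComplexOrder

variable {W : Type*} [Fintype W] [DecidableEq W] (Γ : SimpleGraph W) [DecidableRel Γ.Adj]
  (V : Finset W) (α₀ t : ℝ)

/-- The diffusion operator as a linear map. -/
def diffusionLinear (η : V → ℂ) : (Vert Γ V → ℂ) →ₗ[ℂ] (Vert Γ V → ℂ) where
  toFun := diffusionOp Γ V α₀ t η
  map_add' u w := by
    ext (x | x)
    · simp only [diffusionOp, Pi.add_apply]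
      rw [add_add_add_comm, ← sum_add_distrib]
      congr 1
      · refine sum_congr rfl fun y _ => ?_
        split_ifs <;> ring
      · ring
    · simp only [diffusionOp, Pi.add_apply]
      rw [add_add_add_comm, ← sum_add_distrib]
      congr 1
      · ring
      · refine sum_congr rfl fun y _ => ?_
        split_ifs <;> ring
  map_smul' c u := by
    ext (x | x)
    · simp only [diffusionOp, Pi.smul_apply, smul_eq_mul, RingHom.id_apply, mul_add, mul_sum]
      congr 1
      · refine sum_congr rfl fun y _ => ?_
        split_ifs <;> ring
      · ring
    · simp only [diffusionOp, Pi.smul_apply, smul_eq_mul, RingHom.id_apply, mul_add, mul_sum]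
      congr 1
      · ring
      · refine sum_congr rfl fun y _ => ?_
        split_ifs <;> ring

theorem diffusionMatrix_mulVec (η : V → ℂ) (u : Vert Γ V → ℂ) :
    (diffusionMatrix Γ V α₀ t η).mulVec u = diffusionOp Γ V α₀ t η u := by
  have h : diffusionMatrix Γ V α₀ t η = LinearMap.toMatrix' (diffusionLinear Γ V α₀ t η) := by
    ext x y
    rw [LinearMap.toMatrix'_apply]
    simp only [diffusionMatrix, Matrix.of_apply]
    rfl
  rw [h, LinearMap.toMatrix'_mulVec]
  rfl

theorem diffusionOp_eq_add (η η' : V → ℂ) (u : Vert Γ V → ℂ) :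
    diffusionOp Γ V α₀ t η u = diffusionOp Γ V α₀ t η' u +
      fun x => Sum.elim (fun v => (α₀ : ℂ) * (η v - η' v)) 0 x * u x := by
  ext (x | x)
  · simp only [diffusionOp, Pi.add_apply, Sum.elim_inl]
    ring
  · simp [diffusionOp]

theorem diffusionMatrix_eq_add (η η' : V → ℂ) :
    diffusionMatrix Γ V α₀ t η = diffusionMatrix Γ V α₀ t η' +
      Matrix.diagonal (Sum.elim (fun v => (α₀ : ℂ) * (η v - η' v)) 0) := by
  apply Matrix.toLin'.injective
  refine LinearMap.ext fun u => ?_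
  rw [Matrix.toLin'_apply, Matrix.toLin'_apply, Matrix.add_mulVec, diffusionMatrix_mulVec,
    diffusionMatrix_mulVec, diffusionOp_eq_add Γ V α₀ t η η']
  congr 1
  ext x
  rw [Matrix.mulVec_diagonal]

theorem isUnit_det_diffusionMatrix {η : V → ℂ}
    (h : ∀ u, diffusionOp Γ V α₀ t η u = 0 → u = 0) :
    IsUnit (diffusionMatrix Γ V α₀ t η).det := by
  rw [← Matrix.isUnit_iff_isUnit_det, ← Matrix.mulVec_injective_iff_isUnit]
  refine (injective_iff_map_eq_zero (diffusionMatrix Γ V α₀ t η).mulVecLin).2 fun u hu => h u ?_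
  rwa [Matrix.mulVecLin_apply, diffusionMatrix_mulVec] at hu

/-- The resolvent identity for the Green's functions of two potentials. -/
theorem green_sub_green {η η' : V → ℂ} (h : IsUnit (diffusionMatrix Γ V α₀ t η).det)
    (h' : IsUnit (diffusionMatrix Γ V α₀ t η').det) (x y : Vert Γ V) :
    green Γ V α₀ t η' x y - green Γ V α₀ t η x y =
      α₀ * ∑ v : V, green Γ V α₀ t η' x (Sum.inl v) * (η v - η' v) *
        green Γ V α₀ t η (Sum.inl v) y := by
  have hmat : green Γ V α₀ t η' - green Γ V α₀ t η = green Γ V α₀ t η' *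
      Matrix.diagonal (Sum.elim (fun v => (α₀ : ℂ) * (η v - η' v)) 0) * green Γ V α₀ t η := by
    -- The two operators differ by a diagonal matrix supported on `V`; placing this difference
    -- between the two inverses gives the difference of the inverses.
    have hd : Matrix.diagonal (Sum.elim (fun v => (α₀ : ℂ) * (η v - η' v)) 0) =
        diffusionMatrix Γ V α₀ t η - diffusionMatrix Γ V α₀ t η' :=
      (sub_eq_of_eq_add' (diffusionMatrix_eq_add Γ V α₀ t η η')).symm
    rw [hd, green, green, Matrix.mul_sub, Matrix.sub_mul, Matrix.nonsing_inv_mul _ h',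
      Matrix.mul_assoc, Matrix.mul_nonsing_inv _ h, Matrix.mul_one, Matrix.one_mul]
  rw [← Matrix.sub_apply, hmat, Matrix.mul_apply, Fintype.sum_sum_type, mul_sum]
  simp only [Matrix.mul_diagonal, Sum.elim_inl, Sum.elim_inr, Pi.zero_apply, mul_zero, zero_mul,
    sum_const_zero, add_zero]
  exact sum_congr rfl fun v _ => by ring

/-- The maximum principle. -/
theorem re_nonneg_of_diffusionOp_re_nonneg (hα₀ : 0 < α₀) (ht : 0 ≤ t) {η : V → ℂ}
    (hη : ∀ v, 0 ≤ η v) {u : Vert Γ V → ℂ} (hu : ∀ x, 0 ≤ (diffusionOp Γ V α₀ t η u x).re)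
    (x : Vert Γ V) : 0 ≤ (u x).re := by
  have : Nonempty (Vert Γ V) := ⟨x⟩
  obtain ⟨x₀, hx₀⟩ := Finite.exists_min fun x => (u x).re
  refine le_trans ?_ (hx₀ x)
  by_contra! hneg
  -- At a negative minimum inside `V` the Laplacian is at most zero and the absorption term is
  -- strictly negative, a contradiction.
  have hV : ∀ v : V, (∀ y, (u (Sum.inl v)).re ≤ (u y).re) → 0 ≤ (u (Sum.inl v)).re := by
    intro v hv
    by_contra! hlt
    have h := hu (Sum.inl v)
    obtain ⟨a, ha, hav⟩ : ∃ a : ℝ, 0 ≤ a ∧ η v = a :=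
      ⟨(η v).re, (Complex.nonneg_iff.1 (hη v)).1,
        Complex.ext (by simp) (by simpa using (Complex.nonneg_iff.1 (hη v)).2.symm)⟩
    have hre : ((α₀ : ℂ) * (1 + η v) * u (Sum.inl v)).re = α₀ * (1 + a) * (u (Sum.inl v)).re := by
      rw [hav, ← Complex.ofReal_one, ← Complex.ofReal_add, ← Complex.ofReal_mul,
        Complex.re_ofReal_mul]
    rw [diffusionOp, Complex.add_re, hre, Complex.re_sum] at h
    have hsum : ∑ y : Vert Γ V, (if Γ.Adj (v : W) (Vert.toW Γ V y) then
        u (Sum.inl v) - u y else 0).re ≤ 0 := sum_nonpos fun y _ => by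
      split_ifs
      · rw [Complex.sub_re]; linarith [hv y]
      · simp
    have : α₀ * (1 + a) * (u (Sum.inl v)).re < 0 := mul_neg_of_pos_of_neg (by positivity) hlt
    linarith
  rcases x₀ with v | b
  · exact absurd (hV v hx₀) (not_le.2 hneg)
  · have h := hu (Sum.inr b)
    obtain ⟨-, y, hy, hadj⟩ : (b : W) ∉ V ∧ ∃ y ∈ V, Γ.Adj (b : W) y := by
      simpa [boundary] using b.2
    rw [diffusionOp, Complex.add_re, Complex.re_ofReal_mul, Complex.re_sum] at h
    -- At a negative minimum on the boundary all terms of the Robin condition are nonpositive, so a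
    -- neighbour in `V` attains the same minimum. This reduces to the interior case, also when `t =
    -- 0`.
    have hsum : ∑ z : V, (if Γ.Adj (b : W) (z : W) then u (Sum.inr b) - u (Sum.inl z) else 0).re ≤
        (u (Sum.inr b)).re - (u (Sum.inl ⟨y, hy⟩)).re := by
      rw [← add_sum_erase _ _ (mem_univ (⟨y, hy⟩ : V)), if_pos hadj, Complex.sub_re]
      refine add_le_of_nonpos_right (sum_nonpos fun z _ => ?_)
      split_ifs
      · rw [Complex.sub_re]; linarith [hx₀ (Sum.inl z)]
      · simp
    have htu : t * (u (Sum.inr b)).re ≤ 0 := mul_nonpos_of_nonneg_of_nonpos ht hneg.le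
    have hle : (u (Sum.inl ⟨y, hy⟩)).re ≤ (u (Sum.inr b)).re := by linarith
    exact absurd (hV ⟨y, hy⟩ fun z => hle.trans (hx₀ z)) (not_le.2 (hle.trans_lt hneg))

/-- In the complex order `0 ≤ z` includes `z.im = 0`; the vanishing imaginary part comes from the
maximum principle for `I • u` and `-I • u`. -/
theorem nonneg_of_diffusionOp_nonneg (hα₀ : 0 < α₀) (ht : 0 ≤ t) {η : V → ℂ}
    (hη : ∀ v, 0 ≤ η v) {u : Vert Γ V → ℂ} (hu : ∀ x, 0 ≤ diffusionOp Γ V α₀ t η u x)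
    (x : Vert Γ V) : 0 ≤ u x := by
  have hsmul : ∀ c : ℂ, diffusionOp Γ V α₀ t η (c • u) = c • diffusionOp Γ V α₀ t η u :=
    fun c => (diffusionLinear Γ V α₀ t η).map_smul c u
  have h1 := re_nonneg_of_diffusionOp_re_nonneg Γ V α₀ t hα₀ ht hη
    (fun y => (Complex.nonneg_iff.1 (hu y)).1) x
  have h2 := re_nonneg_of_diffusionOp_re_nonneg Γ V α₀ t hα₀ ht hη (u := Complex.I • u)
    (fun y => by simp [hsmul, ← (Complex.nonneg_iff.1 (hu y)).2]) x
  have h3 := re_nonneg_of_diffusionOp_re_nonneg Γ V α₀ t hα₀ ht hη (u := (-Complex.I) • u)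
    (fun y => by rw [hsmul]; simp [ ← (Complex.nonneg_iff.1 (hu y)).2]) x
  simp only [Pi.smul_apply, smul_eq_mul, Complex.I_mul_re, neg_mul, Complex.neg_re, neg_neg,
    Left.nonneg_neg_iff] at h2 h3
  exact Complex.nonneg_iff.2 ⟨h1, le_antisymm h3 h2⟩

theorem isUnit_det_diffusionMatrix_of_nonneg (hα₀ : 0 < α₀) (ht : 0 ≤ t) {η : V → ℂ}
    (hη : ∀ v, 0 ≤ η v) : IsUnit (diffusionMatrix Γ V α₀ t η).det := by
  refine isUnit_det_diffusionMatrix Γ V α₀ t fun u hu => funext fun x => ?_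
  have hneg : diffusionOp Γ V α₀ t η (-u) = 0 := by
    have := (diffusionLinear Γ V α₀ t η).map_neg u
    exact this.trans (neg_eq_zero.2 hu)
  refine le_antisymm ?_ (nonneg_of_diffusionOp_nonneg Γ V α₀ t hα₀ ht hη (fun y => by simp [hu]) x)
  exact neg_nonneg.1 (nonneg_of_diffusionOp_nonneg Γ V α₀ t hα₀ ht hη (u := -u)
    (fun y => by simp [hneg]) x)

theorem green_nonneg (hα₀ : 0 < α₀) (ht : 0 ≤ t) {η : V → ℂ} (hη : ∀ v, 0 ≤ η v)
    (x y : Vert Γ V) : 0 ≤ green Γ V α₀ t η x y := by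
  refine nonneg_of_diffusionOp_nonneg Γ V α₀ t hα₀ ht hη
    (u := fun z => green Γ V α₀ t η z y) (fun z => ?_) x
  have hone := Matrix.mul_nonsing_inv _ (isUnit_det_diffusionMatrix_of_nonneg Γ V α₀ t hα₀ ht hη)
  rw [← diffusionMatrix_mulVec]
  have : (diffusionMatrix Γ V α₀ t η).mulVec (fun z => green Γ V α₀ t η z y) z =
      (1 : Matrix (Vert Γ V) (Vert Γ V) ℂ) z y := by rw [← hone]; rfl
  rw [this, Matrix.one_apply]
  split_ifs <;> simp

variable (R S : Finset ↥(boundary Γ V)) {p q : ℝ≥0∞}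

theorem scatteringData_sub {η η' : V → ℂ} (h : IsUnit (diffusionMatrix Γ V α₀ t η).det)
    (h' : IsUnit (diffusionMatrix Γ V α₀ t η').det) (rs : R × S) :
    scatteringData Γ V R S α₀ t η rs - scatteringData Γ V R S α₀ t η' rs =
      α₀ * ∑ v : V, green Γ V α₀ t η' (Sum.inr rs.1.1) (Sum.inl v) * (η v - η' v) *
        green Γ V α₀ t η (Sum.inl v) (Sum.inr rs.2.1) := by
  rw [← green_sub_green Γ V α₀ t h h', scatteringData, scatteringData, robinToDirichlet,
    robinToDirichlet]
  ring

theorem scatteringData_zero : scatteringData Γ V R S α₀ t 0 = 0 := by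
  ext rs
  simp [scatteringData, robinToDirichlet]

theorem scatteringData_mono (hα₀ : 0 < α₀) (ht : 0 ≤ t) {η η' : V → ℂ} (hη' : ∀ v, 0 ≤ η' v)
    (hle : ∀ v, η' v ≤ η v) (rs : R × S) :
    scatteringData Γ V R S α₀ t η' rs ≤ scatteringData Γ V R S α₀ t η rs := by
  have hη : ∀ v, 0 ≤ η v := fun v => (hη' v).trans (hle v)
  rw [← sub_nonneg, scatteringData_sub Γ V α₀ t R S
    (isUnit_det_diffusionMatrix_of_nonneg Γ V α₀ t hα₀ ht hη)
    (isUnit_det_diffusionMatrix_of_nonneg Γ V α₀ t hα₀ ht hη')]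
  refine mul_nonneg (by exact_mod_cast hα₀.le) (sum_nonneg fun v _ => ?_)
  exact mul_nonneg (mul_nonneg (green_nonneg Γ V α₀ t hα₀ ht hη' _ _) (sub_nonneg.2 (hle v)))
    (green_nonneg Γ V α₀ t hα₀ ht hη _ _)

theorem lpNorm_scatteringData_mono (hp : 1 ≤ p) (hα₀ : 0 < α₀) (ht : 0 ≤ t) {η η' : V → ℂ}
    (hη' : ∀ v, 0 ≤ η' v) (hle : ∀ v, η' v ≤ η v) :
    lpNorm p (scatteringData Γ V R S α₀ t η') ≤ lpNorm p (scatteringData Γ V R S α₀ t η) := by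
  refine lpNorm_mono hp fun rs => ?_
  have h0 : 0 ≤ scatteringData Γ V R S α₀ t η' rs := by
    simpa [scatteringData_zero] using
      scatteringData_mono Γ V α₀ t R S hα₀ ht (η' := 0) (fun _ => le_rfl) hη' rs
  have h1 := scatteringData_mono Γ V α₀ t R S hα₀ ht hη' hle rs
  rw [← Complex.real_le_real, Complex.norm_of_nonneg' h0, Complex.norm_of_nonneg' (h0.trans h1)]
  exact h1

/-- For `u` in the kernel, `x = η u` on `V` satisfies `x = -α₀ D_η G₀ x`, a map of `ℓ^1` norm at
most `μ ‖η‖_p < 1`. Hence `x = 0`, and then `u = 0`. Positivity is not available for complex `η`. -/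
theorem isUnit_det_diffusionMatrix_of_lpNorm_lt (hpq : p⁻¹ + q⁻¹ = 1) (hp : 1 ≤ p)
    (hα₀ : 0 < α₀) (ht : 0 ≤ t) {η : V → ℂ} (hη : mu Γ V α₀ t q * lpNorm p η < 1) :
    IsUnit (diffusionMatrix Γ V α₀ t η).det := by
  have hdet0 := isUnit_det_diffusionMatrix_of_nonneg Γ V α₀ t hα₀ ht (η := 0) fun _ => le_rfl
  refine isUnit_det_diffusionMatrix Γ V α₀ t fun u hu => ?_
  set x : V → ℂ := fun v => η v * u (Sum.inl v) with hx
  set d : Vert Γ V → ℂ := fun y => Sum.elim (fun v => (α₀ : ℂ) * (η v - (0 : V → ℂ) v)) 0 y * u y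
    with hd
  have hu0 : diffusionOp Γ V α₀ t 0 u = -d := by
    rw [diffusionOp_eq_add Γ V α₀ t η 0] at hu
    exact eq_neg_of_add_eq_zero_left hu
  have hug : u = (green Γ V α₀ t 0).mulVec (-d) := by
    rw [← hu0, ← diffusionMatrix_mulVec, Matrix.mulVec_mulVec, green,
      Matrix.nonsing_inv_mul _ hdet0, Matrix.one_mulVec]
  have huV : ∀ v, u (Sum.inl v) = -(α₀ : ℂ) * (greenVV Γ V α₀ t).mulVec x v := by
    intro v
    conv_lhs => rw [hug]
    rw [Matrix.mulVec, dotProduct, Fintype.sum_sum_type, Matrix.mulVec, dotProduct, mul_sum]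
    simp only [hd, hx, Pi.neg_apply, Sum.elim_inl, Sum.elim_inr, Pi.zero_apply, zero_mul, neg_zero,
      mul_zero, sum_const_zero, add_zero, sub_zero, greenVV, Matrix.submatrix_apply]
    exact sum_congr rfl fun w _ => by ring
  have hxx : ∀ v, ‖x v‖ = α₀ * ‖(Matrix.diagonal η * greenVV Γ V α₀ t).mulVec x v‖ := by
    intro v
    rw [← Matrix.mulVec_mulVec, Matrix.mulVec_diagonal, hx]
    dsimp only
    rw [huV, norm_mul, norm_mul, norm_mul, norm_neg, Complex.norm_of_nonneg hα₀.le]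
    ring
  have hbound := sum_norm_diagonal_mul_mulVec_le hpq hp η x (greenVV Γ V α₀ t)
    (lpNorm_greenVV_le Γ V α₀ t hα₀)
  have hsum : ∑ v, ‖x v‖ ≤ mu Γ V α₀ t q * lpNorm p η * ∑ v, ‖x v‖ := by
    calc ∑ v, ‖x v‖ = α₀ * ∑ v, ‖(Matrix.diagonal η * greenVV Γ V α₀ t).mulVec x v‖ := by
          rw [mul_sum]; exact sum_congr rfl fun v _ => hxx v
      _ ≤ α₀ * (lpNorm p η * (mu Γ V α₀ t q / α₀) * ∑ v, ‖x v‖) := by gcongr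
      _ = _ := by field_simp
  have hnn : 0 ≤ ∑ v, ‖x v‖ := sum_nonneg fun _ _ => norm_nonneg _
  have hzero : ∑ v, ‖x v‖ = 0 := by
    by_contra hne
    have hpos := lt_of_le_of_ne hnn (Ne.symm hne)
    nlinarith
  have hx0 : x = 0 := funext fun v =>
    norm_eq_zero.1 ((sum_eq_zero_iff_of_nonneg fun _ _ => norm_nonneg _).1 hzero v (mem_univ v))
  have hd0 : d = 0 := by
    ext (v | b)
    · have := congrFun hx0 v
      simp only [hx, Pi.zero_apply] at this
      simp [hd, mul_assoc, this]
    · simp [hd]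
  rw [hug, hd0, neg_zero, Matrix.mulVec_zero]

/-- The Born series converges to the scattering data. -/
theorem tendsto_sum_bornOp (hpq : p⁻¹ + q⁻¹ = 1) (hp : 1 ≤ p) (hq : 1 ≤ q)
    (hα₀ : 0 < α₀) (ht : 0 ≤ t) {η : V → ℂ} (hη : mu Γ V α₀ t q * lpNorm p η < 1) (rs : R × S) :
    Tendsto (fun N => ∑ k ∈ range N, bornOp Γ V R S α₀ t (k + 1) (fun _ => η) rs) atTop
      (𝓝 (scatteringData Γ V R S α₀ t η rs)) := by
  have hdet0 := isUnit_det_diffusionMatrix_of_nonneg Γ V α₀ t hα₀ ht (η := 0) fun _ => le_rfl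
  have hdet := isUnit_det_diffusionMatrix_of_lpNorm_lt Γ V α₀ t hpq hp hα₀ ht hη
  set a := greenRV Γ V R α₀ t rs.1 with ha
  set T := Matrix.diagonal η * greenVV Γ V α₀ t with hT
  set y₀ : V → ℂ := (Matrix.diagonal η).mulVec fun v => greenVS Γ V S α₀ t v rs.2 with hy₀
  set y : V → ℂ := fun v => η v * green Γ V α₀ t η (Sum.inl v) (Sum.inr rs.2.1) with hy
  have hphi : scatteringData Γ V R S α₀ t η rs = α₀ * (a ⬝ᵥ y) := by
    have := scatteringData_sub Γ V α₀ t R S hdet hdet0 rs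
    rw [scatteringData_zero, Pi.zero_apply, sub_zero] at this
    rw [this, dotProduct]
    congr 1
    refine sum_congr rfl fun v _ => ?_
    simp only [ha, hy, greenRV, Matrix.submatrix_apply, Pi.zero_apply, sub_zero]
    ring
  -- The resolvent identity multiplied by `η`. Iterating it produces the Born terms and an exact
  -- remainder containing `T ^ N`, which decays like `(μ ‖η‖_p)^N`.
  have hyy : y = y₀ - (α₀ : ℂ) • T.mulVec y := by
    ext v
    have := green_sub_green Γ V α₀ t hdet hdet0 (Sum.inl v) (Sum.inr rs.2.1)
    have hgv : green Γ V α₀ t η (Sum.inl v) (Sum.inr rs.2.1) =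
        green Γ V α₀ t 0 (Sum.inl v) (Sum.inr rs.2.1) -
          α₀ * ((greenVV Γ V α₀ t).mulVec y v) := by
      have hsum : (greenVV Γ V α₀ t).mulVec y v = ∑ w : V,
          green Γ V α₀ t 0 (Sum.inl v) (Sum.inl w) * (η w - (0 : V → ℂ) w) *
            green Γ V α₀ t η (Sum.inl w) (Sum.inr rs.2.1) :=
        sum_congr rfl fun w _ => by
          simp only [hy, greenVV, Matrix.submatrix_apply, Pi.zero_apply, sub_zero]
          ring
      rw [hsum, ← this, sub_sub_cancel]
    simp only [Pi.sub_apply, Pi.smul_apply, smul_eq_mul, hT, hy₀]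
    rw [← Matrix.mulVec_mulVec, Matrix.mulVec_diagonal, Matrix.mulVec_diagonal, greenVS,
      Matrix.submatrix_apply]
    conv_lhs => rw [hy]
    dsimp only
    rw [hgv]
    ring
  have hterm : ∀ k, bornOp Γ V R S α₀ t (k + 1) (fun _ => η) rs =
      -(-(α₀ : ℂ)) ^ (k + 1) * (a ⬝ᵥ (T ^ k).mulVec y₀) := by
    intro k
    have h : bornOp Γ V R S α₀ t (k + 1) (fun _ => η) rs = -(-(α₀ : ℂ)) ^ (k + 1) *
        (greenRV Γ V R α₀ t * (List.ofFn fun _ : Fin k => T).prod * Matrix.diagonal η *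
          greenVS Γ V S α₀ t) rs.1 rs.2 := rfl
    rw [h, List.ofFn_const, List.prod_replicate, mul_mul_diagonal_mul_apply]
  have hrem : ∀ N, scatteringData Γ V R S α₀ t η rs -
      ∑ k ∈ range N, bornOp Γ V R S α₀ t (k + 1) (fun _ => η) rs =
        α₀ * (-(α₀ : ℂ)) ^ N * (a ⬝ᵥ (T ^ N).mulVec y) := by
    intro N
    induction N with
    | zero => simp [hphi]
    | succ N ih =>
      rw [sum_range_succ, ← sub_sub, ih, hterm]
      have : (T ^ N).mulVec y = (T ^ N).mulVec y₀ - (α₀ : ℂ) • (T ^ (N + 1)).mulVec y := by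
        conv_lhs => rw [hyy]
        rw [Matrix.mulVec_sub, Matrix.mulVec_smul, pow_succ, ← Matrix.mulVec_mulVec y (T ^ N) T]
      rw [this, dotProduct_sub, dotProduct_smul, smul_eq_mul]
      ring
  have hμ := mu_nonneg (q := q) Γ V α₀ t hα₀.le hq
  have hη0 : 0 ≤ mu Γ V α₀ t q * lpNorm p η := mul_nonneg hμ (lpNorm_nonneg hp η)
  have hnorm : ∀ N, ‖scatteringData Γ V R S α₀ t η rs -
      ∑ k ∈ range N, bornOp Γ V R S α₀ t (k + 1) (fun _ => η) rs‖ ≤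
        (mu Γ V α₀ t q * lpNorm p η) ^ N * (α₀ * (lpNorm q a * ∑ v, ‖y v‖)) := by
    intro N
    have h2 := sum_norm_ofFn_prod_mulVec_le hpq hp (greenVV Γ V α₀ t)
      (div_nonneg hμ hα₀.le) (lpNorm_greenVV_le Γ V α₀ t hα₀) y N fun _ => η
    rw [List.ofFn_const, List.prod_replicate, prod_const, card_univ, Fintype.card_fin] at h2
    rw [hrem, norm_mul, norm_mul, norm_pow, norm_neg, Complex.norm_of_nonneg hα₀.le]
    calc _ ≤ α₀ * α₀ ^ N * (lpNorm q a *
          ((lpNorm p η * (mu Γ V α₀ t q / α₀)) ^ N * ∑ v, ‖y v‖)) := by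
          gcongr
          exact (norm_dotProduct_le (norm_le_lpNorm hq a)).trans
            (mul_le_mul_of_nonneg_left h2 (lpNorm_nonneg hq a))
      _ = _ := by
          rw [mul_pow, mul_pow, div_pow]
          field_simp
  have hlim : Tendsto (fun N => (mu Γ V α₀ t q * lpNorm p η) ^ N *
      (α₀ * (lpNorm q a * ∑ v, ‖y v‖))) atTop (𝓝 0) := by
    simpa using (tendsto_pow_atTop_nhds_zero_of_lt_one hη0 hη).mul_const
      (α₀ * (lpNorm q a * ∑ v, ‖y v‖))
  have := squeeze_zero_norm hnorm hlim
  simpa using (tendsto_const_nhds (x := scatteringData Γ V R S α₀ t η rs)).sub this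

end Diffusion

end GraphOT

end

noncomputable section

namespace GraphOT

/-! ### The critical point of the majorant and recovery of the potential -/

section Radii

variable {C ν μ : ℝ}

theorem sqrt_div_add_pos (hC : 0 < C) (hν : 0 < ν) : 0 < √(ν / (C + ν)) :=
  Real.sqrt_pos.2 (by positivity)

theorem sqrt_div_add_lt_one (hC : 0 < C) (hν : 0 < ν) : √(ν / (C + ν)) < 1 := by
  rw [Real.sqrt_lt' one_pos, div_lt_iff₀ (by positivity)]
  linarith

theorem sq_sqrt_div_add_mul (hC : 0 < C) (hν : 0 < ν) : √(ν / (C + ν)) ^ 2 * (C + ν) = ν := by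
  rw [Real.sq_sqrt (by positivity)]
  field_simp

/-- The radius of convergence is the maximum of the majorant. -/
theorem majorant_critical_point (hC : 0 < C) (hν : 0 < ν) (hμ : 0 < μ) :
    majorant C (ν / μ) μ (1 / μ * (1 - √(ν / (C + ν)))) =
      C / μ * (1 - 2 * (ν / C) * (√(1 + C / ν) - 1)) := by
  have hs := sqrt_div_add_pos hC hν
  have hs2 := sq_sqrt_div_add_mul hC hν
  have hinv : √(1 + C / ν) = 1 / √(ν / (C + ν)) := by
    rw [one_div, ← Real.sqrt_inv]
    congr 1
    field_simp
    ring
  set s := √(ν / (C + ν))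
  -- Eliminating `C` in favour of `s = 1 - μ ρ` makes both sides rational functions of `s`, `ν` and
  -- `μ`.
  have hCs : C = ν * (1 - s ^ 2) / s ^ 2 := by
    rw [eq_div_iff (by positivity)]
    linarith
  have h1 : 1 - μ * (1 / μ * (1 - s)) = s := by field_simp; ring
  have h2 : μ * (1 / μ * (1 - s)) = 1 - s := by field_simp
  rw [hinv, majorant, h1, h2]
  have h3 : C / μ * (1 - 2 * (ν / C) * (1 / s - 1)) = (C - 2 * ν * (1 / s - 1)) / μ := by
    field_simp
  rw [h3, hCs]
  field_simp
  ring

/-- With `s = √(ν/(C + ν)) < 1` the value is `(C + ν) (1 - s)² / μ`. -/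
theorem majorant_critical_point_pos (hC : 0 < C) (hν : 0 < ν) (hμ : 0 < μ) :
    0 < majorant C (ν / μ) μ (1 / μ * (1 - √(ν / (C + ν)))) := by
  have hs := sqrt_div_add_pos hC hν
  have hs1 := sqrt_div_add_lt_one hC hν
  have hs2 := sq_sqrt_div_add_mul hC hν
  set s := √(ν / (C + ν))
  have h1 : 1 - μ * (1 / μ * (1 - s)) = s := by field_simp; ring
  have h2 : μ * (1 / μ * (1 - s)) = 1 - s := by field_simp
  rw [majorant, h1, h2]
  have h3 : C * (1 / μ * (1 - s)) - ν / μ * ((1 - s) ^ 2 / s) =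
      (1 - s) / (μ * s) * (s * (C + ν) - s ^ 2 * (C + ν)) := by
    rw [hs2]; field_simp; ring
  rw [h3]
  refine mul_pos (div_pos (by linarith) (by positivity)) ?_
  have : s * (C + ν) - s ^ 2 * (C + ν) = s * (1 - s) * (C + ν) := by ring
  rw [this]
  exact mul_pos (mul_pos hs (by linarith)) (by positivity)

theorem mul_lt_one_of_lt_critical (hμ : 0 < μ) {s a : ℝ} (hs : 0 < s)
    (ha : a ≤ 1 / μ * (1 - s)) : μ * a < 1 := by
  have : μ * a ≤ μ * (1 / μ * (1 - s)) := by gcongr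
  have h2 : μ * (1 / μ * (1 - s)) = 1 - s := by field_simp
  linarith

/-- This is positivity of the derivative of the majorant at `a`; equality would hold at `1 - μ a =
s`, because `ν / s² = C + ν`. -/
theorem lipschitz_lt_of_lt_critical (hC : 0 < C) (hν : 0 < ν) (hμ : 0 < μ) {a : ℝ}
    (ha : a < 1 / μ * (1 - √(ν / (C + ν)))) :
    ν / μ * μ * (1 / (1 - μ * a) ^ 2 - 1) < C := by
  have hs := sqrt_div_add_pos hC hν
  have hs2 := sq_sqrt_div_add_mul hC hν
  set s := √(ν / (C + ν))
  have h1 : s < 1 - μ * a := by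
    have : μ * a < μ * (1 / μ * (1 - s)) := by gcongr
    have h2 : μ * (1 / μ * (1 - s)) = 1 - s := by field_simp
    linarith
  have h2 : 1 / (1 - μ * a) ^ 2 < 1 / s ^ 2 := by gcongr
  have h3 : ν * (1 / s ^ 2) = C + ν := by
    rw [mul_one_div, div_eq_iff (by positivity)]; linarith
  have h4 : ν / μ * μ = ν := by field_simp
  rw [h4]
  nlinarith

end Radii

section Recovery

open Filter Topology

variable {E F : Type*} [NormedAddCommGroup E] [NormedSpace ℂ E] [NormedAddCommGroup F]
  [NormedSpace ℂ F]

/-- Recovery of every element of the ball of the critical radius from its image under the forward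
series. -/
theorem sum_rightInv_sum [CompleteSpace E] [CompleteSpace F] (p : FormalMultilinearSeries ℂ E F)
    (i : E ≃L[ℂ] F) (h1 : p 1 = (continuousMultilinearCurryFin1 ℂ E F).symm i) (h0 : p 0 = 0)
    {C ν μ : ℝ} (hC : 0 < C) (hν : 0 < ν) (hμ : 0 < μ)
    (hp : ∀ n, ‖p n‖ ≤ ν / μ * μ ^ n) (hi : ∀ x, C * ‖x‖ ≤ ‖i x‖)
    (hi' : ‖(i.symm : F →L[ℂ] E)‖ ≤ C⁻¹) {x : E}
    (hx : ‖x‖ < 1 / μ * (1 - √(ν / (C + ν))))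
    (hpx : ‖p.sum x‖ < majorant C (ν / μ) μ (1 / μ * (1 - √(ν / (C + ν))))) :
    (p.rightInv i 0).sum (p.sum x) = x := by
  have hs := sqrt_div_add_pos hC hν
  set ρ := 1 / μ * (1 - √(ν / (C + ν))) with hρ
  have hμρ : μ * ρ < 1 := mul_lt_one_of_lt_critical hμ hs le_rfl
  have hcont : ContinuousAt (majorant C (ν / μ) μ) ρ := by
    unfold majorant
    have : 1 - μ * ρ ≠ 0 := by linarith
    fun_prop (disch := assumption)
  -- Injectivity needs a radius strictly below `ρ`, since at `ρ` the Lipschitz constant equals `C`.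
  -- By continuity some `a` between `‖x‖` and `ρ` still has majorant above `‖p.sum x‖`.
  obtain ⟨a, hpa, hxa, haρ⟩ := (((hcont.eventually_const_lt hpx).filter_mono
    nhdsWithin_le_nhds).and (Ioo_mem_nhdsLT hx)).exists
  have ha : 0 ≤ a := (norm_nonneg x).trans hxa.le
  have hμa : μ * a < 1 := mul_lt_one_of_lt_critical hμ hs haρ.le
  have hD : 0 ≤ ν / μ := by positivity
  refine eq_of_sum_eq_sum p i h1 h0 hμ hp hi ha hμa (lipschitz_lt_of_lt_critical hC hν hμ haρ)
    (norm_sum_rightInv_le p i hC hD hμ.le hp hi' ha hμa hpa.le) hxa.le ?_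
  exact sum_sum_rightInv p i h1 h0 hC hD hμ hp hi' ha hμa hpa

end Recovery

/-! ### Positivity of the constants `C_p` and `ν_p` -/

section Gain

theorem exists_lpNorm_eq_one {ι : Type*} [Fintype ι] [Nonempty ι] {p : ℝ≥0∞} (hp : 1 ≤ p) :
    ∃ η : ι → ℂ, lpNorm p η = 1 := by
  have : Fact (1 ≤ p) := ⟨hp⟩
  obtain ⟨x, hx⟩ := exists_norm_eq (PiLp p fun _ : ι => ℂ) zero_le_one
  exact ⟨x.ofLp, hx⟩

variable {W : Type*} [Fintype W] [DecidableEq W] (Γ : SimpleGraph W) [DecidableRel Γ.Adj]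
  (V : Finset W) (R S : Finset ↥(boundary Γ V)) (α₀ t : ℝ) {p q : ℝ≥0∞}

theorem minGain_mul_le (hp : 1 ≤ p) (hK : Function.Bijective (bornLin Γ V R S α₀ t))
    (η : V → ℂ) :
    minGain Γ V R S α₀ t p * lpNorm p η ≤ lpNorm p (bornLin Γ V R S α₀ t η) := by
  have : Fact (1 ≤ p) := ⟨hp⟩
  set i := bornEquiv Γ V R S α₀ t p hK
  set x : PiLp p fun _ : V => ℂ := WithLp.toLp p η
  change minGain Γ V R S α₀ t p * ‖x‖ ≤ ‖i x‖
  rcases eq_or_ne x 0 with hx | hx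
  · simp [hx]
  · have hx' : 0 < ‖x‖ := norm_pos_iff.2 hx
    rw [← le_div_iff₀ hx']
    refine csInf_le ⟨0, ?_⟩ ⟨((‖x‖⁻¹ : ℂ) • x).ofLp, ?_, ?_⟩
    · rintro _ ⟨η, -, rfl⟩
      exact lpNorm_nonneg hp _
    · change ‖(‖x‖⁻¹ : ℂ) • x‖ = 1
      simp [norm_smul, hx'.ne']
    · change _ = ‖i ((‖x‖⁻¹ : ℂ) • x)‖
      rw [map_smul, norm_smul, norm_inv, Complex.norm_real, norm_norm, div_eq_inv_mul]

theorem minGain_pos (hp : 1 ≤ p) [Nonempty V] (hK : Function.Bijective (bornLin Γ V R S α₀ t)) :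
    0 < minGain Γ V R S α₀ t p := by
  have : Fact (1 ≤ p) := ⟨hp⟩
  obtain ⟨η₀, hη₀⟩ := exists_lpNorm_eq_one (ι := V) hp
  set i := bornEquiv Γ V R S α₀ t p hK
  have hbound : ∀ x, ‖x‖ ≤ ‖(i.symm : (PiLp p fun _ : R × S => ℂ) →L[ℂ] PiLp p fun _ : V => ℂ)‖ * ‖i x‖ := fun x => by
    simpa using (i.symm : (PiLp p fun _ : R × S => ℂ) →L[ℂ] PiLp p fun _ : V => ℂ).le_opNorm (i x)
  have hpos : 0 < ‖(i.symm : (PiLp p fun _ : R × S => ℂ) →L[ℂ] PiLp p fun _ : V => ℂ)‖ := by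
    refine lt_of_le_of_ne (norm_nonneg _) fun h => ?_
    have := hbound (WithLp.toLp p η₀)
    rw [← h, zero_mul] at this
    change lpNorm p η₀ ≤ 0 at this
    linarith
  refine (inv_pos.2 hpos).trans_le (le_csInf ⟨_, η₀, hη₀, rfl⟩ ?_)
  rintro _ ⟨η, hη, rfl⟩
  rw [inv_le_iff_one_le_mul₀' hpos]
  have := hbound (WithLp.toLp p η)
  rwa [show ‖WithLp.toLp p η‖ = 1 from hη] at this

/-- For a unit vector `η`, `0 < C_p ≤ ‖K_1 η‖_p ≤ ν_p`. -/
theorem nu_pos (hpq : p⁻¹ + q⁻¹ = 1) (hp : 1 ≤ p) (hq : 1 ≤ q) (hα₀ : 0 < α₀) [Nonempty V]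
    (hK : Function.Bijective (bornLin Γ V R S α₀ t)) : 0 < nu Γ V R S α₀ t p q := by
  obtain ⟨η, hη⟩ := exists_lpNorm_eq_one (ι := V) hp
  have h1 := minGain_mul_le Γ V R S α₀ t hp hK η
  have h2 := lpNorm_bornOp_succ_le Γ V R S α₀ t hpq hp hq hα₀ 0 fun _ => η
  rw [hη, mul_one] at h1
  simp only [pow_zero, mul_one, hη, Finset.prod_const_one] at h2
  exact (minGain_pos Γ V R S α₀ t hp hK).trans_le (h1.trans h2)

theorem norm_bornEquiv_symm_le [Fact (1 ≤ p)] [Nonempty V]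
    (hK : Function.Bijective (bornLin Γ V R S α₀ t)) :
    ‖((bornEquiv Γ V R S α₀ t p hK).symm : (PiLp p fun _ : R × S => ℂ) →L[ℂ] PiLp p fun _ : V => ℂ)‖ ≤
      (minGain Γ V R S α₀ t p)⁻¹ := by
  have hC := minGain_pos Γ V R S α₀ t (Fact.out : 1 ≤ p) hK
  refine ContinuousLinearMap.opNorm_le_bound _ (inv_nonneg.2 hC.le) fun y => ?_
  obtain ⟨x, rfl⟩ := (bornEquiv Γ V R S α₀ t p hK).surjective y
  rw [inv_mul_eq_div, le_div_iff₀' hC]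
  have h := minGain_mul_le Γ V R S α₀ t (Fact.out : 1 ≤ p) hK x.ofLp
  rw [ContinuousLinearEquiv.coe_coe, ContinuousLinearEquiv.symm_apply_apply]
  exact h

end Gain

section ErrorBound

/-- Replacing `x` by `y` in the geometric factors and inserting `(1/(1 - τ))^n ≥ 1` only increases
the bound. The spare factor `x < 1` from the exponent `N + 1` gives strictness. -/
theorem remainder_le_bound {M x y τ : ℝ} (hM : 0 ≤ M) (hx : 0 ≤ x) (hx1 : x < 1) (hxy : x ≤ y)
    (hy : y < 1) (hτ0 : 0 ≤ τ) (hτ : τ < 1) (n N : ℕ) :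
    M * (x ^ (N + 1) / (1 - x)) ≤ M * (1 / (1 - τ)) ^ n * y ^ N * (1 / (1 - y)) ∧
      (0 < M → 0 < y →
        M * (x ^ (N + 1) / (1 - x)) < M * (1 / (1 - τ)) ^ n * y ^ N * (1 / (1 - y))) := by
  have hA : 1 ≤ (1 / (1 - τ)) ^ n :=
    one_le_pow₀ (by rw [le_div_iff₀ (by linarith)]; linarith)
  have hy0 : 0 ≤ y := hx.trans hxy
  have h1y : 0 < 1 - y := by linarith
  have hK : 0 ≤ y ^ N * (1 / (1 - y)) := by positivity
  have h1 : M * (x ^ (N + 1) / (1 - x)) ≤ x * (M * (1 / (1 - τ)) ^ n * (y ^ N * (1 / (1 - y)))) := by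
    calc M * (x ^ (N + 1) / (1 - x)) = x * (M * 1 * (x ^ N * (1 / (1 - x)))) := by ring
      _ ≤ _ := by gcongr
  have hB : 0 ≤ M * (1 / (1 - τ)) ^ n * (y ^ N * (1 / (1 - y))) := by positivity
  rw [mul_assoc _ (y ^ N)]
  refine ⟨h1.trans (mul_le_of_le_one_left hB hx1.le), fun hM' hy' => h1.trans_lt ?_⟩
  exact mul_lt_of_lt_one_left (by positivity) hx1

end ErrorBound

end GraphOT

end

noncomputable section

namespace GraphOT

/-! ### Convergence and recovery for the inverse Born series -/

section Main

open Finset Filter Topology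
open scoped ComplexOrder

variable {W : Type*} [Fintype W] [DecidableEq W] (Γ : SimpleGraph W) [DecidableRel Γ.Adj]
  (V : Finset W) (R S : Finset ↥(boundary Γ V)) (α₀ t : ℝ) {p q : ℝ≥0∞}

theorem inverseBornTerm_eq [Fact (1 ≤ p)] (hpq : p⁻¹ + q⁻¹ = 1) (hq : 1 ≤ q) (hα₀ : 0 < α₀)
    (hK : Function.Bijective (bornLin Γ V R S α₀ t)) (m : ℕ) (φ : R × S → ℂ) :
    inverseBornTerm Γ V R S α₀ t m φ =
      ((bornSeries Γ V R S α₀ t hpq hq hα₀).rightInv (bornEquiv Γ V R S α₀ t p hK) 0 m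
        fun _ => WithLp.toLp p φ).ofLp := by
  -- The operators `𝒦_m` are defined by the left-inverse recursion, while the estimates concern the
  -- right inverse; the two formal series agree.
  rw [← FormalMultilinearSeries.leftInv_eq_rightInv _ _ _
    (bornSeries_one Γ V R S α₀ t hpq hq hα₀ hK), ofLp_leftInv_bornSeries]
  rfl

theorem inverseBornSum_eq [Fact (1 ≤ p)] (hpq : p⁻¹ + q⁻¹ = 1) (hq : 1 ≤ q) (hα₀ : 0 < α₀)
    (hK : Function.Bijective (bornLin Γ V R S α₀ t)) (φ : R × S → ℂ) :
    inverseBornSum Γ V R S α₀ t φ =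
      (((bornSeries Γ V R S α₀ t hpq hq hα₀).rightInv (bornEquiv Γ V R S α₀ t p hK) 0).sum
        (WithLp.toLp p φ)).ofLp := by
  rw [inverseBornSum, FormalMultilinearSeries.sum]
  simp_rw [inverseBornTerm_eq Γ V R S α₀ t hpq hq hα₀ hK]
  exact ((PiLp.continuousLinearEquiv p ℂ fun _ : V => ℂ).map_tsum).symm

theorem radius_eq_majorant [Nonempty V] (hpq : p⁻¹ + q⁻¹ = 1) (hp : 1 ≤ p) (hq : 1 ≤ q)
    (hα₀ : 0 < α₀) (hK : Function.Bijective (bornLin Γ V R S α₀ t)) (hμ : 0 < mu Γ V α₀ t q) :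
    radius Γ V R S α₀ t p q =
      majorant (minGain Γ V R S α₀ t p) (nu Γ V R S α₀ t p q / mu Γ V α₀ t q) (mu Γ V α₀ t q)
        (potentialRadius Γ V R S α₀ t p q) :=
  (majorant_critical_point (minGain_pos Γ V R S α₀ t hp hK)
    (nu_pos Γ V R S α₀ t hpq hp hq hα₀ hK) hμ).symm

theorem mu_mul_potentialRadius_lt_one [Nonempty V] (hpq : p⁻¹ + q⁻¹ = 1) (hp : 1 ≤ p)
    (hq : 1 ≤ q) (hα₀ : 0 < α₀) (hK : Function.Bijective (bornLin Γ V R S α₀ t))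
    (hμ : 0 < mu Γ V α₀ t q) :
    mu Γ V α₀ t q * potentialRadius Γ V R S α₀ t p q < 1 :=
  mul_lt_one_of_lt_critical hμ (sqrt_div_add_pos (minGain_pos Γ V R S α₀ t hp hK)
    (nu_pos Γ V R S α₀ t hpq hp hq hα₀ hK)) le_rfl

theorem potentialRadius_pos [Nonempty V] (hpq : p⁻¹ + q⁻¹ = 1) (hp : 1 ≤ p)
    (hq : 1 ≤ q) (hα₀ : 0 < α₀) (hK : Function.Bijective (bornLin Γ V R S α₀ t))
    (hμ : 0 < mu Γ V α₀ t q) : 0 < potentialRadius Γ V R S α₀ t p q :=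
  mul_pos (by positivity) (sub_pos.2 (sqrt_div_add_lt_one (minGain_pos Γ V R S α₀ t hp hK)
    (nu_pos Γ V R S α₀ t hpq hp hq hα₀ hK)))

theorem bornSeries_sum_eq [Fact (1 ≤ p)] (hpq : p⁻¹ + q⁻¹ = 1) (hq : 1 ≤ q) (hα₀ : 0 < α₀)
    (ht : 0 ≤ t) (hμ : 0 < mu Γ V α₀ t q) {η : V → ℂ} (hη : mu Γ V α₀ t q * lpNorm p η < 1) :
    (bornSeries Γ V R S α₀ t hpq hq hα₀).sum (WithLp.toLp p η) =
      WithLp.toLp p (scatteringData Γ V R S α₀ t η) := by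
  have hmem : WithLp.toLp p η ∈ Metric.eball (0 : PiLp p fun _ : V => ℂ)
      (ENNReal.ofReal (mu Γ V α₀ t q)⁻¹) := by
    rw [mem_eball_zero_ofReal_iff, ← one_div, lt_div_iff₀' hμ]
    exact hη
  have hsum := (hasFPowerSeriesOnBall_sum _ hμ
    (norm_bornSeries_le Γ V R S α₀ t hpq hq hα₀ hμ)).hasSum hmem
  rw [zero_add] at hsum
  ext rs
  have hrs := (hsum.mapL (PiLp.proj p (𝕜 := ℂ) (fun _ : R × S => ℂ) rs)).tendsto_sum_nat
  rw [← tendsto_add_atTop_iff_nat 1] at hrs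
  refine tendsto_nhds_unique hrs ?_
  refine (tendsto_sum_bornOp Γ V α₀ t R S hpq Fact.out hq hα₀ ht hη rs).congr fun N => ?_
  rw [sum_range_succ']
  have h0 : bornSeries Γ V R S α₀ t hpq hq hα₀ 0 = 0 := rfl
  simp only [PiLp.proj_apply, bornSeries_apply, h0, zero_apply, PiLp.zero_apply, add_zero]

/-- The inverse Born series on its ball of convergence. -/
theorem hasFPowerSeriesOnBall_inverseBorn [Fact (1 ≤ p)] [Nonempty V] (hpq : p⁻¹ + q⁻¹ = 1)
    (hq : 1 ≤ q) (hα₀ : 0 < α₀) (hK : Function.Bijective (bornLin Γ V R S α₀ t))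
    (hμ : 0 < mu Γ V α₀ t q) :
    HasFPowerSeriesOnBall (fun y : PiLp p fun _ : R × S => ℂ =>
        WithLp.toLp p (inverseBornSum Γ V R S α₀ t y.ofLp))
      ((bornSeries Γ V R S α₀ t hpq hq hα₀).rightInv (bornEquiv Γ V R S α₀ t p hK) 0) 0
      (ENNReal.ofReal (radius Γ V R S α₀ t p q)) := by
  have hC := minGain_pos Γ V R S α₀ t (Fact.out : 1 ≤ p) hK
  have hν := nu_pos Γ V R S α₀ t hpq Fact.out hq hα₀ hK
  have hfun : (fun y : PiLp p fun _ : R × S => ℂ =>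
      WithLp.toLp p (inverseBornSum Γ V R S α₀ t y.ofLp)) =
        ((bornSeries Γ V R S α₀ t hpq hq hα₀).rightInv (bornEquiv Γ V R S α₀ t p hK) 0).sum :=
    funext fun y => by rw [inverseBornSum_eq Γ V R S α₀ t hpq hq hα₀ hK]
  rw [hfun, radius_eq_majorant Γ V R S α₀ t hpq Fact.out hq hα₀ hK hμ]
  exact hasFPowerSeriesOnBall_sum_rightInv _ _ hC (by positivity) hμ.le
    (norm_bornSeries_le Γ V R S α₀ t hpq hq hα₀ hμ) (norm_bornEquiv_symm_le Γ V R S α₀ t hK)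
    (potentialRadius_pos Γ V R S α₀ t hpq Fact.out hq hα₀ hK hμ).le
    (mu_mul_potentialRadius_lt_one Γ V R S α₀ t hpq Fact.out hq hα₀ hK hμ)
    (majorant_critical_point_pos hC hν hμ)

theorem lpNorm_inverseBornSum_le [Nonempty V] (hpq : p⁻¹ + q⁻¹ = 1) (hp : 1 ≤ p)
    (hq : 1 ≤ q) (hα₀ : 0 < α₀) (hK : Function.Bijective (bornLin Γ V R S α₀ t))
    (hμ : 0 < mu Γ V α₀ t q) {φ : R × S → ℂ} (hφ : lpNorm p φ < radius Γ V R S α₀ t p q) :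
    lpNorm p (inverseBornSum Γ V R S α₀ t φ) ≤ potentialRadius Γ V R S α₀ t p q := by
  have : Fact (1 ≤ p) := ⟨hp⟩
  rw [inverseBornSum_eq Γ V R S α₀ t hpq hq hα₀ hK]
  rw [radius_eq_majorant Γ V R S α₀ t hpq hp hq hα₀ hK hμ] at hφ
  have hν := nu_pos Γ V R S α₀ t hpq hp hq hα₀ hK
  exact norm_sum_rightInv_le _ _ (minGain_pos Γ V R S α₀ t hp hK) (by positivity) hμ.le
    (norm_bornSeries_le Γ V R S α₀ t hpq hq hα₀ hμ) (norm_bornEquiv_symm_le Γ V R S α₀ t hK)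
    (potentialRadius_pos Γ V R S α₀ t hpq hp hq hα₀ hK hμ).le
    (mu_mul_potentialRadius_lt_one Γ V R S α₀ t hpq hp hq hα₀ hK hμ) hφ.le

/-- A nonnegative potential with small scattering data is small. -/
theorem lpNorm_lt_potentialRadius_of_nonneg [Nonempty V] (hpq : p⁻¹ + q⁻¹ = 1) (hp : 1 ≤ p)
    (hq : 1 ≤ q) (hα₀ : 0 < α₀) (ht : 0 ≤ t) (hK : Function.Bijective (bornLin Γ V R S α₀ t))
    (hμ : 0 < mu Γ V α₀ t q) {η : V → ℂ} (hη : ∀ v, 0 ≤ η v)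
    (hφ : lpNorm p (scatteringData Γ V R S α₀ t η) < radius Γ V R S α₀ t p q) :
    lpNorm p η < potentialRadius Γ V R S α₀ t p q := by
  have : Fact (1 ≤ p) := ⟨hp⟩
  by_contra! hle
  have hρ := potentialRadius_pos Γ V R S α₀ t hpq hp hq hα₀ hK hμ
  have hμρ := mu_mul_potentialRadius_lt_one Γ V R S α₀ t hpq hp hq hα₀ hK hμ
  rw [radius_eq_majorant Γ V R S α₀ t hpq hp hq hα₀ hK hμ] at hφ
  set ρ := potentialRadius Γ V R S α₀ t p q
  have hηpos : 0 < lpNorm p η := hρ.trans_le hle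
  -- `s • η` lies on the critical sphere and below `η`: the majorant bounds its data from below by
  -- `r_p`, and monotonicity passes this bound to `η`.
  set s : ℝ := ρ / lpNorm p η
  have hs0 : 0 ≤ s := by positivity
  have hs1 : s ≤ 1 := (div_le_one hηpos).2 hle
  have hnorm : lpNorm p ((s : ℂ) • η) = ρ := by
    change ‖(s : ℂ) • WithLp.toLp p η‖ = ρ
    rw [norm_smul, Complex.norm_of_nonneg hs0]
    exact div_mul_cancel₀ ρ hηpos.ne'
  have hsη : ∀ v, 0 ≤ ((s : ℂ) • η) v := fun v => mul_nonneg (by exact_mod_cast hs0) (hη v)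
  have hle' : ∀ v, ((s : ℂ) • η) v ≤ η v := fun v =>
    mul_le_of_le_one_left (hη v) (by exact_mod_cast hs1)
  have hmono := lpNorm_scatteringData_mono (p := p) Γ V α₀ t R S hp hα₀ ht hsη hle'
  have hlow := majorant_le_norm_sum (bornSeries Γ V R S α₀ t hpq hq hα₀)
    (bornEquiv Γ V R S α₀ t p hK) (bornSeries_one Γ V R S α₀ t hpq hq hα₀ hK) rfl hμ
    (norm_bornSeries_le Γ V R S α₀ t hpq hq hα₀ hμ)
    (fun x => minGain_mul_le Γ V R S α₀ t hp hK x.ofLp) (x := WithLp.toLp p ((s : ℂ) • η))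
    (by change _ * lpNorm p ((s : ℂ) • η) < 1; rwa [hnorm])
  rw [bornSeries_sum_eq Γ V R S α₀ t hpq hq hα₀ ht hμ (by rwa [hnorm])] at hlow
  change majorant _ _ _ (lpNorm p ((s : ℂ) • η)) ≤ lpNorm p _ at hlow
  rw [hnorm] at hlow
  exact absurd (hlow.trans hmono) (not_le.2 hφ)

/-- The inverse Born series recovers the potential from its scattering data. -/
theorem inverseBornSum_scatteringData [Nonempty V] (hpq : p⁻¹ + q⁻¹ = 1) (hp : 1 ≤ p)
    (hq : 1 ≤ q) (hα₀ : 0 < α₀) (ht : 0 ≤ t) (hK : Function.Bijective (bornLin Γ V R S α₀ t))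
    (hμ : 0 < mu Γ V α₀ t q) {η : V → ℂ}
    (hη : lpNorm p η < potentialRadius Γ V R S α₀ t p q)
    (hφ : lpNorm p (scatteringData Γ V R S α₀ t η) < radius Γ V R S α₀ t p q) :
    inverseBornSum Γ V R S α₀ t (scatteringData Γ V R S α₀ t η) = η := by
  have : Fact (1 ≤ p) := ⟨hp⟩
  have hμη : mu Γ V α₀ t q * lpNorm p η < 1 :=
    (mul_lt_mul_of_pos_left hη hμ).trans
      (mu_mul_potentialRadius_lt_one Γ V R S α₀ t hpq hp hq hα₀ hK hμ)
  have hsum := bornSeries_sum_eq Γ V R S α₀ t hpq hq hα₀ ht hμ hμη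
  rw [radius_eq_majorant Γ V R S α₀ t hpq hp hq hα₀ hK hμ] at hφ
  rw [inverseBornSum_eq Γ V R S α₀ t hpq hq hα₀ hK, ← hsum, sum_rightInv_sum _ _
    (bornSeries_one Γ V R S α₀ t hpq hq hα₀ hK) rfl (minGain_pos Γ V R S α₀ t hp hK)
    (nu_pos Γ V R S α₀ t hpq hp hq hα₀ hK) hμ
    (norm_bornSeries_le Γ V R S α₀ t hpq hq hα₀ hμ)
    (fun x => minGain_mul_le Γ V R S α₀ t hp hK x.ofLp)
    (norm_bornEquiv_symm_le Γ V R S α₀ t hK) hη (by rw [hsum]; exact hφ)]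

end Main

end GraphOT

end

theorem mainTheorem4 {W : Type*} [Fintype W] [DecidableEq W]
    (Γ : SimpleGraph W) [DecidableRel Γ.Adj] (V : Finset W)
    (hconn : (Γ.induce (V : Set W)).Connected)
    (R S : Finset ↥(GraphOT.boundary Γ V))
    (α₀ t : ℝ) (hα₀ : 0 < α₀) (ht : 0 ≤ t)
    (p q : ENNReal) (hpq : p⁻¹ + q⁻¹ = 1)
    (hcard : V.card = R.card * S.card)
    (hK : Function.Bijective (GraphOT.bornLin Γ V R S α₀ t)) :
    (∀ φ : R × S → ℂ, GraphOT.lpNorm p φ < GraphOT.radius Γ V R S α₀ t p q →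
      Summable fun m : ℕ => GraphOT.inverseBornTerm Γ V R S α₀ t m φ) ∧
    BddAbove (GraphOT.inverseBornNorms Γ V R S α₀ t p q) ∧
    ∀ (η : V → ℂ),
      ((∀ v, ∃ a : ℝ, 0 ≤ a ∧ η v = (a : ℂ)) ∨
        GraphOT.lpNorm p η < GraphOT.potentialRadius Γ V R S α₀ t p q) →
      ∀ (φ : R × S → ℂ), φ = GraphOT.scatteringData Γ V R S α₀ t η →
      ∀ (τ : ℝ), τ < 1 → GraphOT.lpNorm p φ < τ * GraphOT.radius Γ V R S α₀ t p q →
      ∀ (N : ℕ) (err bound : ℝ),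
        err = GraphOT.lpNorm ⊤
          (η - ∑ m ∈ Finset.Icc 1 N, GraphOT.inverseBornTerm Γ V R S α₀ t m φ) →
        bound = sSup (GraphOT.inverseBornNorms Γ V R S α₀ t p q) * (1 / (1 - τ)) ^ V.card *
            (GraphOT.lpNorm p φ / (τ * GraphOT.radius Γ V R S α₀ t p q)) ^ N *
            (1 / (1 - GraphOT.lpNorm p φ / (τ * GraphOT.radius Γ V R S α₀ t p q))) →
        err ≤ bound ∧ (φ ≠ 0 → err < bound) := by
  open GraphOT in
  have hp : 1 ≤ p := by rw [← ENNReal.inv_le_one, ← hpq]; exact le_self_add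
  have hq : 1 ≤ q := by rw [← ENNReal.inv_le_one, ← hpq]; exact le_add_self
  have hpF : Fact (1 ≤ p) := ⟨hp⟩
  have hV : Nonempty V := hconn.nonempty
  rcases (mu_nonneg (q := q) Γ V α₀ t hα₀.le hq).eq_or_lt with hμ | hμ
  -- If `μ_p = 0`, division by zero makes the radius `0`, and no data have norm below it.
  · have hr : radius Γ V R S α₀ t p q = 0 := by rw [radius, ← hμ, div_zero, zero_mul]
    rw [hr]
    refine ⟨fun φ hφ => absurd hφ (not_lt.2 (lpNorm_nonneg hp φ)), ⟨0, ?_⟩,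
      fun η _ φ _ τ _ hφ => absurd hφ (not_lt.2 (by simpa using lpNorm_nonneg hp φ))⟩
    rintro _ ⟨φ, hφ, -⟩
    rw [hr] at hφ
    exact absurd hφ (not_lt.2 (lpNorm_nonneg hp φ))
  have hψ := hasFPowerSeriesOnBall_inverseBorn Γ V R S α₀ t hpq hq hα₀ hK hμ
  have hr : 0 < radius Γ V R S α₀ t p q := by simpa using hψ.r_pos
  have hbdd : BddAbove (inverseBornNorms Γ V R S α₀ t p q) := by
    refine ⟨potentialRadius Γ V R S α₀ t p q, ?_⟩
    rintro _ ⟨φ, hφ, rfl⟩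
    exact lpNorm_inverseBornSum_le Γ V R S α₀ t hpq hp hq hα₀ hK hμ hφ
  refine ⟨fun φ hφ => ?_, hbdd, ?_⟩
  · have hs := (hψ.hasSum (mem_eball_zero_ofReal_iff (y := WithLp.toLp p φ).2 hφ)).mapL
      (PiLp.continuousLinearEquiv p ℂ fun _ : V => ℂ).toContinuousLinearMap
    refine hs.summable.congr fun m => ?_
    rw [inverseBornTerm_eq Γ V R S α₀ t hpq hq hα₀ hK]
    rfl
  rintro η hη φ rfl τ hτ hφ N err bound rfl rfl
  have hτ0 : 0 < τ := pos_of_mul_pos_left ((lpNorm_nonneg hp _).trans_lt hφ) hr.le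
  have hφr : lpNorm p (scatteringData Γ V R S α₀ t η) < radius Γ V R S α₀ t p q :=
    hφ.trans_le (mul_le_of_le_one_left hr.le hτ.le)
  have hηρ : lpNorm p η < potentialRadius Γ V R S α₀ t p q := by
    refine hη.elim (fun h => ?_) id
    refine lpNorm_lt_potentialRadius_of_nonneg Γ V R S α₀ t hpq hp hq hα₀ ht hK hμ (fun v => ?_) hφr
    obtain ⟨a, ha, hav⟩ := h v
    rw [hav]
    exact Complex.zero_le_real.2 ha
  have hrec := inverseBornSum_scatteringData Γ V R S α₀ t hpq hp hq hα₀ ht hK hμ hηρ hφr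
  have hηM : lpNorm p η ≤ sSup (inverseBornNorms Γ V R S α₀ t p q) :=
    le_csSup hbdd ⟨_, hφr, by rw [hrec]⟩
  set φ := scatteringData Γ V R S α₀ t η with hφdef
  set M := sSup (inverseBornNorms Γ V R S α₀ t p q)
  set r := radius Γ V R S α₀ t p q
  have herr : lpNorm ⊤ (η - ∑ m ∈ Finset.Icc 1 N, inverseBornTerm Γ V R S α₀ t m φ) ≤
      M * ((lpNorm p φ / r) ^ (N + 1) / (1 - lpNorm p φ / r)) := by
    refine (lpNorm_top_le hp _).trans ?_
    have h := norm_sub_sum_Icc_le hψ (M := M)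
      (fun y hy => le_csSup hbdd ⟨y.ofLp, hy, rfl⟩)
      (by rw [FormalMultilinearSeries.rightInv_coeff_zero]; ext; simp)
      (y := WithLp.toLp p φ) hφr N
    refine le_of_eq_of_le ?_ h
    simp only [hrec, inverseBornTerm_eq Γ V R S α₀ t hpq hq hα₀ hK]
    rw [lpNorm, WithLp.toLp_sub, WithLp.toLp_sum]
  have hx0 : 0 ≤ lpNorm p φ / r := div_nonneg (lpNorm_nonneg hp φ) hr.le
  have hτr : 0 < τ * r := mul_pos hτ0 hr
  obtain ⟨hle, hlt⟩ := remainder_le_bound ((lpNorm_nonneg hp η).trans hηM) hx0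
    ((div_lt_one hr).2 hφr) (div_le_div_of_nonneg_left (lpNorm_nonneg hp φ) hτr
      (mul_le_of_le_one_left hr.le hτ.le)) ((div_lt_one hτr).2 hφ) hτ0.le hτ V.card N
  refine ⟨herr.trans hle, fun hne => herr.trans_lt (hlt ?_ ?_)⟩
  -- The zero potential has zero data, so `φ ≠ 0` forces `0 < ‖η‖_p ≤ M`.
  · refine lt_of_lt_of_le (norm_pos_iff (a := WithLp.toLp p η).2 fun h => hne ?_) hηM
    have : η = 0 := congrArg WithLp.ofLp h
    rw [hφdef, this, scatteringData_zero]
  · refine div_pos (norm_pos_iff (a := WithLp.toLp p φ).2 fun h => hne ?_) hτr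
    exact congrArg WithLp.ofLp h
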